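/- Let $N\ge 1$ and $(a,b)\in\mathbb R^2$. Functions are real-valued and $C_0^\infty(\mathbb R^N\setminus\{0\})$ denotes the smooth functions with compact support in $\mathbb R^N\setminus\{0\}$. Let $\mathcal H^1_{a,b}$ be the completion of $C_0^\infty(\mathbb R^N\setminus\{0\})$ in the norm $$\|u\|_{\mathcal H^1_{a,b}}=\left(\int_{\mathbb R^N}\left[\frac{|x\cdot\nabla u|^2}{|x|^{2b+2}}+\frac{|u|^2}{|x|^{2a}}\right]dx\right)^{1/2},$$ realized as a space of functions $u$ (modulo null sets) with generalized $x\cdot\nabla u$, the weighted $L^2$-limit of $x\cdot\nabla\varphi_n$ along test functions $\varphi_n\to u$. Put $$\tilde E(u)=\frac{\left(\int_{\mathbb R^N}\frac{|u|^2}{|x|^{2a}}dx\right)^{1/2}\left(\int_{\mathbb R^N}\frac{|x\cdot\nabla u|^2}{|x|^{2b+2}}dx\right)^{1/2}}{\int_{\mathbb R^N}\frac{|u|^2}{|x|^{a+b+1}}dx},\qquad \tilde C(N,a,b)=\inf_{0\ne u\in C_0^\infty(\mathbb R^N\setminus\{0\})}\tilde E(u).$$ Then $\tilde C(N,a,b)$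 is the largest constant for which $$\int_{\mathbb R^N}\frac{|u|^2}{|x|^{2a}}dx\int_{\mathbb R^N}\frac{|x\cdot\nabla u|^2}{|x|^{2b+2}}dx\ \ge\ \tilde C^2(N,a,b)\left(\int_{\mathbb R^N}\frac{|u|^2}{|x|^{a+b+1}}dx\right)^2,\qquad u\in C_0^\infty(\mathbb R^N\setminus\{0\}),\tag{1}$$ and $\tilde C(N,a,b)=\inf_{0\ne u\in\mathcal H^1_{a,b}}\tilde E(u)$. Define $$\mathcal A_1=\{b+1-a>0,\ b\le\tfrac{N-2}2\},\quad \mathcal A_2=\{b+1-a<0,\ b\ge\tfrac{N-2}2\},\quad \mathcal A=\mathcal A_1\cup\mathcal A_2,$$ $$\mathcal B_1=\{b+1-a<0,\ b\le\tfrac{N-2}2\},\quad \mathcal B_2=\{b+1-a>0,\ b\ge\tfrac{N-2}2\},\quad \mathcal B=\mathcal B_1\cup\mathcal B_2.$$ Let $D:S^{N-1}\to\mathbb R$ be any function, not identically zero, such that $x\mapsto D(x/|x|)$ is $C^1$ on $\mathbb R^N\setminus\{0\}$. (a) If $(a,b)\in\mathcal A$, then $\tilde C(N,a,b)=\frac{|N-(a+b+1)|}2$,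 and it is achieved in $\mathcal H^1_{a,b}$ by each function $$u(x)=D\left(\tfrac{x}{|x|}\right)\exp\left(\frac{t|x|^{b+1-a}}{b+1-a}\right),$$ with any $t<0$ if $(a,b)\in\mathcal A_1$ and any $t>0$ if $(a,b)\in\mathcal A_2$. (b) If $(a,b)\in\mathcal B$, then $\tilde C(N,a,b)=\frac{|N-(3b-a+3)|}2$, and it is achieved in $\mathcal H^1_{a,b}$ by each function $$u(x)=D\left(\tfrac{x}{|x|}\right)|x|^{2(b+1)-N}\exp\left(\frac{t|x|^{b+1-a}}{b+1-a}\right),$$ with any $t>0$ if $(a,b)\in\mathcal B_1$ and any $t<0$ if $(a,b)\in\mathcal B_2$. (c) If $a=b+1$, then for each $u\in C_0^\infty(\mathbb R^N\setminus\{0\})$ the inequality (1) is equivalent (with any constant in place of $\tilde C$) to the weighted Hardy inequality $$\int_{\mathbb R^N}\frac{|x\cdot\nabla u|^2}{|x|^{2b+2}}dx\ \ge\ \tilde C^2(N,b+1,b)\int_{\mathbb R^N}\frac{|u|^2}{|x|^{2b+2}}dx ,$$ whose best constant is thus also $\tilde C(N,b+1,b)$. Its value is $\tilde C(N,b+1,b)=\frac{|N-2(b+1)|}2$,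 and it is not achieved in $\mathcal H^1_{b+1,b}$. -/

import Mathlib

open scoped ENNReal ContDiff Topology

/-- `C_0^∞(ℝ^N \ {0})`: smooth real functions whose (closed) support is a compact subset of
`ℝ^N \ {0}`. -/
def CKNTest {N : ℕ} (u : EuclideanSpace ℝ (Fin N) → ℝ) : Prop :=
  ContDiff ℝ ∞ u ∧ HasCompactSupport u ∧ (0 : EuclideanSpace ℝ (Fin N)) ∉ tsupport u

/-- `x · ∇u(x)`, written as the derivative of `u` at `x` applied to the vector `x`. -/
noncomputable def xDotGrad {N : ℕ} (u : EuclideanSpace ℝ (Fin N) → ℝ) :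
    EuclideanSpace ℝ (Fin N) → ℝ :=
  fun x => fderiv ℝ u x x

/-- The weighted integral `∫ |f|² / |x|^s dx`, with values in `[0, ∞]`. -/
noncomputable def weightedSq {N : ℕ} (s : ℝ) (f : EuclideanSpace ℝ (Fin N) → ℝ) : ℝ≥0∞ :=
  ∫⁻ x, ENNReal.ofReal (|f x| ^ 2 / ‖x‖ ^ s)

/-- The quotient
`(∫ |u|²/|x|^{2a})^{1/2} (∫ |G|²/|x|^{2b+2})^{1/2} / ∫ |u|²/|x|^{a+b+1}`,
where `G` plays the role of `x · ∇u`. -/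
noncomputable def cknQuotient {N : ℕ} (a b : ℝ) (u G : EuclideanSpace ℝ (Fin N) → ℝ) : ℝ≥0∞ :=
  weightedSq (2 * a) u ^ (1 / 2 : ℝ) * weightedSq (2 * b + 2) G ^ (1 / 2 : ℝ)
    / weightedSq (a + b + 1) u

/-- The inequality
`∫ |u|²/|x|^{2a} · ∫ |x·∇u|²/|x|^{2b+2} ≥ C² (∫ |u|²/|x|^{a+b+1})²` for the function `u`. -/
def CKNIneq {N : ℕ} (a b : ℝ) (C : ℝ≥0∞) (u : EuclideanSpace ℝ (Fin N) → ℝ) : Prop :=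
  C ^ 2 * weightedSq (a + b + 1) u ^ 2 ≤
    weightedSq (2 * a) u * weightedSq (2 * b + 2) (xDotGrad u)

/-- The weighted Hardy inequality `∫ |x·∇u|²/|x|^{2b+2} ≥ C² ∫ |u|²/|x|^{2b+2}` for the
function `u`. -/
def HardyIneq {N : ℕ} (b : ℝ) (C : ℝ≥0∞) (u : EuclideanSpace ℝ (Fin N) → ℝ) : Prop :=
  C ^ 2 * weightedSq (2 * b + 2) u ≤ weightedSq (2 * b + 2) (xDotGrad u)

/-- The best constant: the infimum of the quotient over nonzero `u ∈ C_0^∞(ℝ^N \ {0})`. -/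
noncomputable def cknConst (N : ℕ) (a b : ℝ) : ℝ≥0∞ :=
  ⨅ (u : EuclideanSpace ℝ (Fin N) → ℝ) (_ : CKNTest u) (_ : u ≠ 0),
    cknQuotient a b u (xDotGrad u)

/-- Membership in the completion of `C_0^∞(ℝ^N \ {0})` for the norm
`(∫ |x·∇u|²/|x|^{2b+2} + |u|²/|x|^{2a})^{1/2}`. As the two weighted `L²` spaces are complete, a
Cauchy sequence `φ n` of test functions has a limit `u` in the first one, while `x·∇(φ n)` has a
limit `G` in the second one (the generalized `x·∇u`); the completion consists of the functions
`u` that arise so, up to null sets, and its norm and the quotient are evaluated with `G`. -/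
def MemCKNSpace {N : ℕ} (a b : ℝ) (u G : EuclideanSpace ℝ (Fin N) → ℝ) : Prop :=
  MeasureTheory.AEStronglyMeasurable u MeasureTheory.volume ∧
  MeasureTheory.AEStronglyMeasurable G MeasureTheory.volume ∧
  ∃ φ : ℕ → EuclideanSpace ℝ (Fin N) → ℝ, (∀ n, CKNTest (φ n)) ∧
    Filter.Tendsto (fun n => weightedSq (2 * b + 2) (fun x => xDotGrad (φ n) x - G x)
      + weightedSq (2 * a) (fun x => φ n x - u x)) Filter.atTop (𝓝 0)

/-- The infimum of the quotient over the nonzero elements of the completion. -/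
noncomputable def cknConstCompletion (N : ℕ) (a b : ℝ) : ℝ≥0∞ :=
  ⨅ (u : EuclideanSpace ℝ (Fin N) → ℝ) (G : EuclideanSpace ℝ (Fin N) → ℝ)
    (_ : MemCKNSpace a b u G) (_ : ¬ u =ᵐ[MeasureTheory.volume] 0), cknQuotient a b u G

/-- `u`, with generalized `x·∇u` equal to `G`, is a nonzero element of the completion at which the
quotient takes the value of the best constant. -/
def CKNAchievedBy {N : ℕ} (a b : ℝ) (u G : EuclideanSpace ℝ (Fin N) → ℝ) : Prop :=
  MemCKNSpace a b u G ∧ ¬ u =ᵐ[MeasureTheory.volume] 0 ∧ cknQuotient a b u G = cknConst N a b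

def regionA1 (N : ℕ) : Set (ℝ × ℝ) := {p | p.2 + 1 - p.1 > 0 ∧ p.2 ≤ ((N : ℝ) - 2) / 2}
def regionA2 (N : ℕ) : Set (ℝ × ℝ) := {p | p.2 + 1 - p.1 < 0 ∧ p.2 ≥ ((N : ℝ) - 2) / 2}
def regionA (N : ℕ) : Set (ℝ × ℝ) := regionA1 N ∪ regionA2 N
def regionB1 (N : ℕ) : Set (ℝ × ℝ) := {p | p.2 + 1 - p.1 < 0 ∧ p.2 ≤ ((N : ℝ) - 2) / 2}
def regionB2 (N : ℕ) : Set (ℝ × ℝ) := {p | p.2 + 1 - p.1 > 0 ∧ p.2 ≥ ((N : ℝ) - 2) / 2}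
def regionB (N : ℕ) : Set (ℝ × ℝ) := regionB1 N ∪ regionB2 N

/-- `D`, of which only the values on the unit sphere matter, is an admissible angular profile:
`x ↦ D(x/|x|)` is `C¹` on `ℝ^N \ {0}`, and `D` is not identically zero on the sphere. -/
def AngularProfile {N : ℕ} (D : EuclideanSpace ℝ (Fin N) → ℝ) : Prop :=
  ContDiffOn ℝ 1 (fun x : EuclideanSpace ℝ (Fin N) => D (‖x‖⁻¹ • x)) {0}ᶜ ∧
    ∃ σ : EuclideanSpace ℝ (Fin N), ‖σ‖ = 1 ∧ D σ ≠ 0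

/-- `D(x/|x|) exp(t |x|^{b+1-a} / (b+1-a))` -/
noncomputable def minimizerA {N : ℕ} (a b t : ℝ) (D : EuclideanSpace ℝ (Fin N) → ℝ) :
    EuclideanSpace ℝ (Fin N) → ℝ :=
  fun x => D (‖x‖⁻¹ • x) * Real.exp (t * ‖x‖ ^ (b + 1 - a) / (b + 1 - a))

/-- `D(x/|x|) |x|^{2(b+1)-N} exp(t |x|^{b+1-a} / (b+1-a))` -/
noncomputable def minimizerB {N : ℕ} (a b t : ℝ) (D : EuclideanSpace ℝ (Fin N) → ℝ) :
    EuclideanSpace ℝ (Fin N) → ℝ :=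
  fun x => D (‖x‖⁻¹ • x) * ‖x‖ ^ (2 * (b + 1) - (N : ℝ))
    * Real.exp (t * ‖x‖ ^ (b + 1 - a) / (b + 1 - a))

/-! Only the derivative along rays enters, so the angular variable is a free parameter, and every
profile `D` gives a minimizer. The main tool is the integrated Euler identity ∫ x·∇h = -N ∫ h.
Applied to h = u²|x|^{-s} it gives 2∫ u (x·∇u)|x|^{-s} = -(N-s) ∫ u²|x|^{-s}.

Lower bound (`CKNTest.cknIneq`): replacing x·∇u by x·∇u - γu changes the integral of the square
against |x|^{-(2b+2)} by γ(γ+N-2b-2) ∫ u²|x|^{-(2b+2)}. This vanishes exactly for γ = 0 and γ =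
2(b+1)-N, or when u does. For both values, Cauchy-Schwarz applied to u|x|^{-a} and (x·∇u -
γu)|x|^{-(b+1)} bounds the quotient below by |N-(a+b+1)+2γ|/2, for all (a,b).

Equality: Cauchy-Schwarz is sharp when x·∇u - γu = t|x|^k u with k = b+1-a, that is u =
D(x/|x|)|x|^γ exp(t|x|^k/k). The sign conditions defining the regions A (γ = 0) and B (the other γ),
with the sign of t, place this profile in the completion (`AngularProfile.powerExpProfile_spec`).
Membership comes from cutoffs in log|x| followed by mollification (`memCKNSpace_of_contDiffOn`). The
infimum over the completion is not smaller than the one over test functions, by norm convergence in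
the numerator and Fatou in the denominator.

On a = b+1 the weights coincide and (1) is Hardy's inequality. Its sharpness follows by testing with
log cutoffs times the critical power |x|^{-(N-2b-2)/2} (`cknConst_hardy`). Equality would make the
remainder in the completed square vanish along an approximating sequence. A weighted estimate of u
by this remainder (`CKNTest.weightedSq_mul_hardyWeight_sq_le`) then forces u = 0. -/

open MeasureTheory Filter Set

/-! ### Calculus of the operator x·∇ and Euler's identity for compact support. -/

section Calculus

variable {N : ℕ} {u v f g : EuclideanSpace ℝ (Fin N) → ℝ} {x : EuclideanSpace ℝ (Fin N)}

/-- The chain rule along l ↦ l x at l = 1 reduces x·∇ to a one-variable derivative; this serves both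
radial functions and functions of x/|x|. -/
theorem xDotGrad_eq_of_hasDerivAt_ray {c : ℝ} (hu : DifferentiableAt ℝ u x)
    (h : HasDerivAt (fun l : ℝ => u (l • x)) c 1) : xDotGrad u x = c := by
  have h1 : HasDerivAt (fun l : ℝ => l • x) x 1 := by
    simpa using (hasDerivAt_id (1 : ℝ)).smul_const x
  have h2 : HasFDerivAt u (fderiv ℝ u x) ((1 : ℝ) • x) := by simpa using hu.hasFDerivAt
  exact (h2.comp_hasDerivAt (1 : ℝ) h1).unique h

theorem xDotGrad_mul (hu : DifferentiableAt ℝ u x) (hv : DifferentiableAt ℝ v x) :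
    xDotGrad (fun y => u y * v y) x = u x * xDotGrad v x + v x * xDotGrad u x := by
  simp only [xDotGrad]
  rw [fderiv_fun_mul hu hv]
  simp

theorem xDotGrad_sq (hu : DifferentiableAt ℝ u x) :
    xDotGrad (fun y => u y ^ 2) x = 2 * u x * xDotGrad u x := by
  have := xDotGrad_mul hu hu
  simp only [← sq] at this
  rw [this]; ring

theorem xDotGrad_radial {p : ℝ → ℝ} {p' : ℝ} (hx : x ≠ 0) (hp : HasDerivAt p p' ‖x‖) :
    xDotGrad (fun y => p ‖y‖) x = ‖x‖ * p' := by
  have hn : DifferentiableAt ℝ (fun y : EuclideanSpace ℝ (Fin N) => ‖y‖) x :=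
    (contDiffAt_norm (n := 1) ℝ hx).differentiableAt one_ne_zero
  refine xDotGrad_eq_of_hasDerivAt_ray (hp.differentiableAt.comp x hn) ?_
  have h1 : HasDerivAt (fun l : ℝ => l * ‖x‖) ‖x‖ 1 := by
    simpa using (hasDerivAt_id (1 : ℝ)).mul_const ‖x‖
  have h2 : HasDerivAt (fun l : ℝ => p (l * ‖x‖)) (p' * ‖x‖) 1 :=
    HasDerivAt.comp (h₂ := p) (1 : ℝ) (by simpa using hp) h1
  rw [mul_comm]
  refine h2.congr_of_eventuallyEq ?_
  filter_upwards [lt_mem_nhds (zero_lt_one (α := ℝ))] with l hl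
  rw [norm_smul, Real.norm_of_nonneg hl.le]

theorem xDotGrad_norm_rpow (s : ℝ) (hx : x ≠ 0) :
    xDotGrad (fun y => ‖y‖ ^ s) x = s * ‖x‖ ^ s := by
  have hx' := norm_pos_iff.2 hx
  rw [xDotGrad_radial (p := fun r => r ^ s) hx (Real.hasDerivAt_rpow_const (Or.inl hx'.ne')),
    Real.rpow_sub_one hx'.ne']
  field_simp

theorem contDiffOn_radial {p : ℝ → ℝ} {n : ℕ∞ω} (hp : ContDiffOn ℝ n p (Ioi 0)) :
    ContDiffOn ℝ n (fun y : EuclideanSpace ℝ (Fin N) => p ‖y‖) {0}ᶜ := by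
  refine hp.comp (fun y hy => (contDiffAt_norm ℝ hy).contDiffWithinAt) ?_
  intro y hy
  exact norm_pos_iff.2 hy

theorem contDiffOn_norm_rpow (s : ℝ) (n : ℕ∞ω) :
    ContDiffOn ℝ n (fun y : EuclideanSpace ℝ (Fin N) => ‖y‖ ^ s) {0}ᶜ :=
  contDiffOn_radial (p := fun r => r ^ s)
    fun _ hr => (Real.contDiffAt_rpow_const_of_ne (ne_of_gt hr)).contDiffWithinAt

theorem ContDiffOn.differentiableAt_of_ne_zero (hu : ContDiffOn ℝ 1 u {0}ᶜ) (hx : x ≠ 0) :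
    DifferentiableAt ℝ u x :=
  (hu.contDiffAt (isOpen_compl_singleton.mem_nhds hx)).differentiableAt one_ne_zero

theorem ContDiffOn.continuousOn_xDotGrad (hu : ContDiffOn ℝ 1 u {0}ᶜ) :
    ContinuousOn (xDotGrad u) {0}ᶜ :=
  (hu.continuousOn_fderiv_of_isOpen isOpen_compl_singleton le_rfl).clm_apply continuousOn_id

theorem ContDiff.continuous_xDotGrad (hu : ContDiff ℝ 1 u) : Continuous (xDotGrad u) :=
  (hu.continuous_fderiv one_ne_zero).clm_apply continuous_id

theorem tsupport_xDotGrad_subset : tsupport (xDotGrad u) ⊆ tsupport u := by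
  refine closure_minimal (fun x hx => ?_) (isClosed_tsupport u)
  refine support_fderiv_subset ℝ (f := u) ?_
  intro h
  exact hx (by simp [xDotGrad, h])

theorem HasCompactSupport.xDotGrad (hu : HasCompactSupport u) : HasCompactSupport (xDotGrad u) :=
  hu.mono' ((subset_tsupport _).trans tsupport_xDotGrad_subset)

/-- Since `f` vanishes identically near the origin, a singularity of `g` there is harmless. This is
what lets power weights multiply test functions and cutoffs. -/
theorem contDiff_mul_of_zero_notMem_tsupport {n : ℕ∞ω} (hf : ContDiff ℝ n f)
    (h0 : (0 : EuclideanSpace ℝ (Fin N)) ∉ tsupport f) (hg : ContDiffOn ℝ n g {0}ᶜ) :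
    ContDiff ℝ n (fun y => f y * g y) := by
  rw [contDiff_iff_contDiffAt]
  intro x
  by_cases hx : x = 0
  · subst hx
    have h1 : (fun y => f y * g y) =ᶠ[𝓝 0] fun _ => 0 := by
      filter_upwards [notMem_tsupport_iff_eventuallyEq.1 h0] with y hy
      simp [hy]
    exact contDiffAt_const.congr_of_eventuallyEq h1
  · exact hf.contDiffAt.mul (hg.contDiffAt (isOpen_compl_singleton.mem_nhds hx))

theorem zero_notMem_tsupport_mul (h0 : (0 : EuclideanSpace ℝ (Fin N)) ∉ tsupport f) :
    (0 : EuclideanSpace ℝ (Fin N)) ∉ tsupport (fun y => f y * g y) :=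
  fun h => h0 (closure_mono (Function.support_mul_subset_left f g) h)

theorem continuous_mul_of_zero_notMem_tsupport (hf : Continuous f)
    (h0 : (0 : EuclideanSpace ℝ (Fin N)) ∉ tsupport f) (hg : ContinuousOn g {0}ᶜ) :
    Continuous (fun y => f y * g y) :=
  contDiff_zero.1 (contDiff_mul_of_zero_notMem_tsupport (contDiff_zero.2 hf) h0
    (contDiffOn_zero.2 hg))

theorem integrable_mul_of_zero_notMem_tsupport (hf : Continuous f) (hc : HasCompactSupport f)
    (h0 : (0 : EuclideanSpace ℝ (Fin N)) ∉ tsupport f) (hg : ContinuousOn g {0}ᶜ) :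
    Integrable (fun y => f y * g y) :=
  (continuous_mul_of_zero_notMem_tsupport hf h0 hg).integrable_of_hasCompactSupport hc.mul_right

theorem continuousOn_norm_rpow (s : ℝ) :
    ContinuousOn (fun y : EuclideanSpace ℝ (Fin N) => ‖y‖ ^ s) {0}ᶜ :=
  (contDiffOn_norm_rpow s 0).continuousOn

theorem CKNTest.zero_notMem_xDotGrad (hu : CKNTest u) :
    (0 : EuclideanSpace ℝ (Fin N)) ∉ tsupport (xDotGrad u) :=
  fun h => hu.2.2 (tsupport_xDotGrad_subset h)

theorem CKNTest.contDiff_one (hu : CKNTest u) : ContDiff ℝ 1 u := hu.1.of_le (by simp)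

theorem CKNTest.mul_right (hu : CKNTest u) (hg : ContDiffOn ℝ ∞ g {0}ᶜ) :
    CKNTest (fun y => u y * g y) :=
  ⟨contDiff_mul_of_zero_notMem_tsupport hu.1 hu.2.2 hg, hu.2.1.mul_right,
    zero_notMem_tsupport_mul hu.2.2⟩

/-- Euler's identity, integrated: `∫ x · ∇h = - N ∫ h` for compactly supported `h`. -/
theorem integral_xDotGrad_of_hasCompactSupport {h : EuclideanSpace ℝ (Fin N) → ℝ}
    (hh : ContDiff ℝ 1 h) (hc : HasCompactSupport h) :
    Integrable (xDotGrad h) ∧ ∫ x, xDotGrad h x = - (N : ℝ) * ∫ x, h x := by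
  have hd : Differentiable ℝ h := hh.differentiable one_ne_zero
  have hint : Integrable h := hh.continuous.integrable_of_hasCompactSupport hc
  have hcoord (i : Fin N) (x : EuclideanSpace ℝ (Fin N)) :
      fderiv ℝ (fun y : EuclideanSpace ℝ (Fin N) => y i) x (EuclideanSpace.single i 1) = 1 := by
    have : HasFDerivAt (fun y : EuclideanSpace ℝ (Fin N) => y i)
        (EuclideanSpace.proj (𝕜 := ℝ) i) x := (EuclideanSpace.proj (𝕜 := ℝ) i).hasFDerivAt
    rw [this.fderiv]; simp
  have hi (i : Fin N) : Integrable (fun x : EuclideanSpace ℝ (Fin N) =>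
      x i * fderiv ℝ h x (EuclideanSpace.single i 1)) := by
    have h1 : Continuous fun x : EuclideanSpace ℝ (Fin N) => x i := by fun_prop
    have h2 : Continuous fun x => fderiv ℝ h x (EuclideanSpace.single i 1) :=
      (hh.continuous_fderiv one_ne_zero).clm_apply continuous_const
    exact (h1.mul h2).integrable_of_hasCompactSupport
      (HasCompactSupport.mul_left (hc.fderiv_apply ℝ _))
  -- Integration by parts against the i-th coordinate function, whose i-th partial derivative is 1;
  -- summing over i produces the factor N.
  have hparts (i : Fin N) :
      ∫ x : EuclideanSpace ℝ (Fin N), x i * fderiv ℝ h x (EuclideanSpace.single i 1)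
        = - ∫ x, h x := by
    rw [integral_mul_fderiv_eq_neg_fderiv_mul_of_integrable
      (f := fun x : EuclideanSpace ℝ (Fin N) => x i)]
    · simp [hcoord]
    · simpa [hcoord] using hint
    · exact hi i
    · exact Continuous.integrable_of_hasCompactSupport (by have := hh.continuous; fun_prop) hc.mul_left
    · intro x _; fun_prop
    · intro x _; exact hd x
  have hsum : xDotGrad h = fun x => ∑ i, x i * fderiv ℝ h x (EuclideanSpace.single i 1) := by
    funext x
    have hx : x = ∑ i, x i • EuclideanSpace.single i (1 : ℝ) := by
      ext j
      simp [Finset.sum_apply, Pi.single_apply]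
    conv_lhs => rw [xDotGrad]; rw [hx, map_sum]
    rw [← hx]
    simp
  rw [hsum]
  refine ⟨integrable_finsetSum _ fun i _ => hi i, ?_⟩
  rw [integral_finsetSum _ fun i _ => hi i]
  simp [hparts]

end Calculus

/-! ### Logarithmic cutoffs and Euler's identity for functions singular at the origin. -/

section Cutoff

variable {N : ℕ} {u v f g : EuclideanSpace ℝ (Fin N) → ℝ} {x : EuclideanSpace ℝ (Fin N)}

theorem xDotGrad_zero (u : EuclideanSpace ℝ (Fin N) → ℝ) : xDotGrad u 0 = 0 := by
  simp [xDotGrad]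

theorem xDotGrad_mul_of_contDiffOn (hf : ContDiff ℝ 1 f) (hg : ContDiffOn ℝ 1 g {0}ᶜ) (x) :
    xDotGrad (fun y => f y * g y) x = f x * xDotGrad g x + g x * xDotGrad f x := by
  by_cases hx : x = 0
  · simp [hx, xDotGrad_zero]
  · exact xDotGrad_mul (hf.differentiable one_ne_zero x) (hg.differentiableAt_of_ne_zero hx)

/-- A smooth bump on the line which is `1` on `[-1, 1]` and vanishes off `(-2, 2)`. -/
noncomputable def lineBump : ContDiffBump (0 : ℝ) := ⟨1, 2, one_pos, one_lt_two⟩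

/-- Cutoff function in the variable `log ‖x‖`, at scale `n + 1`. -/
noncomputable def logCutoff (N n : ℕ) : EuclideanSpace ℝ (Fin N) → ℝ :=
  fun x => ({0}ᶜ : Set (EuclideanSpace ℝ (Fin N))).indicator
    (fun y => lineBump (Real.log ‖y‖ / (n + 1))) x

/-- The closed annulus `exp (-R) ≤ ‖x‖ ≤ exp R`. -/
def logAnnulus (N : ℕ) (R : ℝ) : Set (EuclideanSpace ℝ (Fin N)) :=
  {x | Real.exp (-R) ≤ ‖x‖ ∧ ‖x‖ ≤ Real.exp R}

theorem mem_logAnnulus {R : ℝ} (hx : x ≠ 0) : x ∈ logAnnulus N R ↔ |Real.log ‖x‖| ≤ R := by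
  rw [abs_le, logAnnulus, mem_ofPred_eq, Real.le_log_iff_exp_le (norm_pos_iff.2 hx),
    Real.log_le_iff_le_exp (norm_pos_iff.2 hx)]

theorem isCompact_logAnnulus (R : ℝ) : IsCompact (logAnnulus N R) := by
  refine (isCompact_closedBall (0 : EuclideanSpace ℝ (Fin N)) (Real.exp R)).of_isClosed_subset ?_ ?_
  · exact (isClosed_le continuous_const continuous_norm).inter
      (isClosed_le continuous_norm continuous_const)
  · intro x hx
    simpa using hx.2

theorem logAnnulus_subset (R : ℝ) : logAnnulus N R ⊆ {0}ᶜ := by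
  rintro x hx rfl
  have := hx.1
  simp only [norm_zero] at this
  exact absurd (Real.exp_pos (-R)) (not_lt.2 this)

theorem logCutoff_apply (n : ℕ) (hx : x ≠ 0) :
    logCutoff N n x = lineBump (Real.log ‖x‖ / (n + 1)) := by
  simp [logCutoff, hx]

theorem support_logCutoff_subset (n : ℕ) :
    Function.support (logCutoff N n) ⊆ logAnnulus N (2 * (n + 1)) := by
  intro x hx
  have hx0 : x ≠ 0 := by
    rintro rfl
    exact hx (by simp [logCutoff])
  rw [mem_logAnnulus hx0]
  rw [Function.mem_support, logCutoff_apply n hx0] at hx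
  have h1 : Real.log ‖x‖ / (n + 1) ∈ Function.support (lineBump : ℝ → ℝ) := hx
  rw [lineBump.support_eq] at h1
  have hn : (0 : ℝ) < n + 1 := by positivity
  have h2 : |Real.log ‖x‖ / (n + 1)| < 2 := by
    rw [← Real.dist_0_eq_abs]
    exact h1
  rw [abs_div, abs_of_pos hn, div_lt_iff₀ hn] at h2
  exact h2.le

theorem tsupport_logCutoff_subset (n : ℕ) :
    tsupport (logCutoff N n) ⊆ logAnnulus N (2 * (n + 1)) :=
  closure_minimal (support_logCutoff_subset n) (isCompact_logAnnulus _).isClosed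

theorem ckntest_logCutoff (n : ℕ) : CKNTest (logCutoff N n) := by
  have h0 : (0 : EuclideanSpace ℝ (Fin N)) ∉ tsupport (logCutoff N n) :=
    fun h => logAnnulus_subset _ (tsupport_logCutoff_subset n h) rfl
  refine ⟨?_, (isCompact_logAnnulus _).of_isClosed_subset (isClosed_tsupport _)
    (tsupport_logCutoff_subset n), h0⟩
  rw [contDiff_iff_contDiffAt]
  intro x
  by_cases hx : x = 0
  · subst hx
    exact contDiffAt_const.congr_of_eventuallyEq (notMem_tsupport_iff_eventuallyEq.1 h0)
  · have h1 : ContDiffAt ℝ ∞ (fun y : EuclideanSpace ℝ (Fin N) =>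
        lineBump (Real.log ‖y‖ / (n + 1))) x :=
      lineBump.contDiff.contDiffAt.comp x
        (((contDiffAt_norm ℝ hx).log (norm_pos_iff.2 hx).ne').div_const _)
    refine h1.congr_of_eventuallyEq ?_
    filter_upwards [isOpen_compl_singleton.mem_nhds hx] with y hy
    exact logCutoff_apply n hy

theorem logCutoff_nonneg (n : ℕ) (x) : 0 ≤ logCutoff N n x :=
  indicator_nonneg (fun _ _ => lineBump.nonneg) x

theorem logCutoff_le_one (n : ℕ) (x) : logCutoff N n x ≤ 1 :=
  indicator_le' (fun _ _ => lineBump.le_one) (fun _ _ => zero_le_one) x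

theorem logCutoff_eq_one (n : ℕ) (hx : x ∈ logAnnulus N (n + 1)) : logCutoff N n x = 1 := by
  have hx0 : x ≠ 0 := logAnnulus_subset _ hx
  rw [logCutoff_apply n hx0]
  apply lineBump.one_of_mem_closedBall
  rw [mem_logAnnulus hx0] at hx
  have hn : (0 : ℝ) < n + 1 := by positivity
  simpa [lineBump, abs_div, abs_of_pos hn, div_le_iff₀ hn] using hx

theorem tendsto_logCutoff (hx : x ≠ 0) : Tendsto (fun n => logCutoff N n x) atTop (𝓝 1) := by
  obtain ⟨n₀, hn₀⟩ := exists_nat_ge |Real.log ‖x‖|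
  refine tendsto_const_nhds.congr' ?_
  filter_upwards [eventually_ge_atTop n₀] with n hn
  rw [logCutoff_eq_one n ((mem_logAnnulus hx).2 _)]
  have : (n₀ : ℝ) ≤ n := by exact_mod_cast hn
  linarith

/-- On radial functions x·∇ is differentiation in log|x|, so stretching by n + 1 in that variable
divides the derivative by n + 1, uniformly in x. -/
theorem exists_abs_xDotGrad_logCutoff_le (N : ℕ) :
    ∃ M : ℝ, 0 ≤ M ∧ ∀ n x, |xDotGrad (logCutoff N n) x| ≤ M / (n + 1) := by
  have hd : Continuous (deriv lineBump) := (lineBump.contDiff (n := 1)).continuous_deriv le_rfl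
  obtain ⟨M, hM⟩ := hd.bounded_above_of_compact_support lineBump.hasCompactSupport.deriv
  refine ⟨M, (norm_nonneg _).trans (hM 0), fun n x => ?_⟩
  have hn : (0 : ℝ) < n + 1 := by positivity
  have hM0 := (norm_nonneg _).trans (hM 0)
  by_cases hx : x = 0
  · simp only [hx, xDotGrad_zero, abs_zero]
    positivity
  have hx' := norm_pos_iff.2 hx
  have h1 : xDotGrad (logCutoff N n) x
      = xDotGrad (fun y : EuclideanSpace ℝ (Fin N) => lineBump (Real.log ‖y‖ / (n + 1))) x := by
    simp only [xDotGrad]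
    rw [Filter.EventuallyEq.fderiv_eq]
    filter_upwards [isOpen_compl_singleton.mem_nhds hx] with y hy
    exact logCutoff_apply n hy
  have h2 : HasDerivAt (fun r : ℝ => lineBump (Real.log r / (n + 1)))
      (deriv lineBump (Real.log ‖x‖ / (n + 1)) * (‖x‖⁻¹ / (n + 1))) ‖x‖ :=
    HasDerivAt.comp (h₂ := lineBump) ‖x‖
      ((lineBump.contDiff (n := 1)).differentiable one_ne_zero _).hasDerivAt
      ((Real.hasDerivAt_log hx'.ne').div_const _)
  rw [h1, xDotGrad_radial (p := fun r => lineBump (Real.log r / (n + 1))) hx h2]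
  have h3 : ‖x‖ * (deriv lineBump (Real.log ‖x‖ / (n + 1)) * (‖x‖⁻¹ / (n + 1)))
      = deriv lineBump (Real.log ‖x‖ / (n + 1)) / (n + 1) := by
    field_simp
  rw [h3, abs_div, abs_of_pos hn]
  gcongr
  exact hM _

theorem integrableOn_logAnnulus (hg : ContinuousOn g {0}ᶜ) (R : ℝ) :
    IntegrableOn g (logAnnulus N R) :=
  (hg.mono (logAnnulus_subset R)).integrableOn_compact (isCompact_logAnnulus R)

/-- In polar coordinates |x|^{-N} dx is surface measure times d(log r). The factor N vol(B) is the
area of the sphere and 2R is the length of [-R, R]. -/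
theorem setIntegral_logAnnulus_norm_rpow [NeZero N] {R : ℝ} (hR : 0 ≤ R) :
    ∫ x in logAnnulus N R, ‖x‖ ^ (-(N : ℝ))
      = N * volume.real (Metric.ball (0 : EuclideanSpace ℝ (Fin N)) 1) * (2 * R) := by
  have hm : MeasurableSet (logAnnulus N R) := (isCompact_logAnnulus R).isClosed.measurableSet
  have h1 : ∀ x : EuclideanSpace ℝ (Fin N),
      (logAnnulus N R).indicator (fun x => ‖x‖ ^ (-(N : ℝ))) x
        = (Icc (Real.exp (-R)) (Real.exp R)).indicator (fun r => r ^ (-(N : ℝ))) ‖x‖ := by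
    intro x
    by_cases hx : x ∈ logAnnulus N R
    · rw [indicator_of_mem hx, indicator_of_mem (show ‖x‖ ∈ Icc _ _ from hx)]
    · rw [indicator_of_notMem hx, indicator_of_notMem (show ‖x‖ ∉ Icc _ _ from hx)]
  rw [← integral_indicator hm]
  simp_rw [h1]
  rw [integral_fun_norm_addHaar volume
    ((Icc (Real.exp (-R)) (Real.exp R)).indicator (fun r => r ^ (-(N : ℝ))))]
  have hle : Real.exp (-R) ≤ Real.exp R := Real.exp_le_exp.2 (by linarith)
  have h2 : ∫ y in Ioi (0 : ℝ), y ^ (Module.finrank ℝ (EuclideanSpace ℝ (Fin N)) - 1) •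
      (Icc (Real.exp (-R)) (Real.exp R)).indicator (fun r => r ^ (-(N : ℝ))) y = 2 * R := by
    have h3 : ∀ y : ℝ, y ^ (Module.finrank ℝ (EuclideanSpace ℝ (Fin N)) - 1) •
        (Icc (Real.exp (-R)) (Real.exp R)).indicator (fun r => r ^ (-(N : ℝ))) y
          = (Icc (Real.exp (-R)) (Real.exp R)).indicator (fun r => r⁻¹) y := by
      intro y
      by_cases hy : y ∈ Icc (Real.exp (-R)) (Real.exp R)
      · have hy0 : 0 < y := (Real.exp_pos _).trans_le hy.1
        rw [indicator_of_mem hy, indicator_of_mem hy, finrank_euclideanSpace_fin, smul_eq_mul,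
          ← Real.rpow_natCast, ← Real.rpow_add hy0, Nat.cast_pred (Nat.pos_of_neZero N),
          ← Real.rpow_neg_one]
        congr 1; ring
      · simp [indicator_of_notMem hy]
    simp_rw [h3]
    rw [setIntegral_indicator measurableSet_Icc,
      inter_eq_self_of_subset_right (show Icc (Real.exp (-R)) (Real.exp R) ⊆ Ioi 0 from
        fun y hy => (Real.exp_pos _).trans_le hy.1),
      integral_Icc_eq_integral_Ioc, ← intervalIntegral.integral_of_le hle,
      integral_inv_of_pos (Real.exp_pos _) (Real.exp_pos _), ← Real.exp_sub, Real.log_exp]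
    ring
  rw [h2]
  simp [nsmul_eq_mul, mul_assoc]

theorem ae_ne_zero [NeZero N] : ∀ᵐ x : EuclideanSpace ℝ (Fin N), x ≠ 0 :=
  compl_mem_ae_iff.2 (measure_singleton 0)

theorem tendsto_integral_logCutoff_mul [NeZero N] {F : EuclideanSpace ℝ (Fin N) → ℝ}
    (hF : Integrable F) :
    Tendsto (fun n => ∫ x, logCutoff N n x * F x) atTop (𝓝 (∫ x, F x)) := by
  refine tendsto_integral_of_dominated_convergence (fun x => ‖F x‖) ?_ hF.norm ?_ ?_
  · exact fun n => (ckntest_logCutoff n).1.continuous.aestronglyMeasurable.mul hF.1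
  · intro n
    filter_upwards with x
    rw [norm_mul, Real.norm_of_nonneg (logCutoff_nonneg n x)]
    exact mul_le_of_le_one_left (norm_nonneg _) (logCutoff_le_one n x)
  · filter_upwards [ae_ne_zero] with x hx
    simpa using (tendsto_logCutoff hx).mul_const (F x)

/-- Euler's identity, integrated, for functions that may be singular at the origin. -/
theorem integral_xDotGrad [NeZero N] {h : EuclideanSpace ℝ (Fin N) → ℝ}
    (hh : ContDiffOn ℝ 1 h {0}ᶜ) (hi : Integrable h) (hi' : Integrable (xDotGrad h)) :
    ∫ x, xDotGrad h x = - (N : ℝ) * ∫ x, h x := by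
  obtain ⟨M, hM0, hM⟩ := exists_abs_xDotGrad_logCutoff_le N
  have hc (n : ℕ) := (ckntest_logCutoff (N := N) n).contDiff_one
  have hprod (n : ℕ) : ContDiff ℝ 1 (fun x => logCutoff N n x * h x) :=
    contDiff_mul_of_zero_notMem_tsupport (hc n) (ckntest_logCutoff n).2.2 hh
  have hbd (n : ℕ) : ∀ x, ‖h x * xDotGrad (logCutoff N n) x‖ ≤ M / (n + 1) * ‖h x‖ := by
    intro x
    rw [norm_mul, mul_comm]
    exact mul_le_mul_of_nonneg_right (hM n x) (norm_nonneg _)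
  have hi2 (n : ℕ) : Integrable (fun x => h x * xDotGrad (logCutoff N n) x) :=
    (hi.norm.const_mul (M / (n + 1))).mono'
      (hi.1.mul (hc n).continuous_xDotGrad.aestronglyMeasurable) (ae_of_all _ (hbd n))
  have hi1 (n : ℕ) : Integrable (fun x => logCutoff N n x * xDotGrad h x) :=
    hi'.norm.mono' ((hc n).continuous.aestronglyMeasurable.mul hi'.1) (ae_of_all _ fun x => by
      rw [norm_mul, Real.norm_of_nonneg (logCutoff_nonneg n x)]
      exact mul_le_of_le_one_left (norm_nonneg _) (logCutoff_le_one n x))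
  have hid (n : ℕ) : (∫ x, logCutoff N n x * xDotGrad h x)
      + ∫ x, h x * xDotGrad (logCutoff N n) x = - (N : ℝ) * ∫ x, logCutoff N n x * h x := by
    rw [← (integral_xDotGrad_of_hasCompactSupport (hprod n)
      (ckntest_logCutoff n).2.1.mul_right).2, ← integral_add (hi1 n) (hi2 n)]
    simp_rw [xDotGrad_mul_of_contDiffOn (hc n) hh]
  -- The cutoff error is at most M/(n+1) times ∫ |h|, so no decay of h beyond integrability is
  -- needed.
  have hlim0 : Tendsto (fun n : ℕ => ∫ x, h x * xDotGrad (logCutoff N n) x) atTop (𝓝 0) := by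
    have hz : Tendsto (fun n : ℕ => M / ((n : ℝ) + 1) * ∫ x, ‖h x‖) atTop (𝓝 0) := by
      have := (tendsto_one_div_add_atTop_nhds_zero_nat (𝕜 := ℝ)).const_mul M
      simpa [div_eq_mul_inv] using this.mul_const (∫ x, ‖h x‖)
    refine squeeze_zero_norm (fun n => ?_) hz
    rw [← integral_const_mul]
    exact norm_integral_le_of_norm_le (hi.norm.const_mul _) (ae_of_all _ (hbd n))
  refine tendsto_nhds_unique ?_ ((tendsto_integral_logCutoff_mul hi).const_mul (-(N : ℝ)))
  simpa [← hid] using (tendsto_integral_logCutoff_mul hi').add hlim0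

end Cutoff

/-! ### Weighted L² norms, and convergence of them along approximating sequences. -/

section WeightedNorm

variable {N : ℕ} {u v f g : EuclideanSpace ℝ (Fin N) → ℝ} {a b s : ℝ}

/-- The weighted norm whose square is `weightedSq s f`. -/
noncomputable def weightedNorm (s : ℝ) (f : EuclideanSpace ℝ (Fin N) → ℝ) : ℝ≥0∞ :=
  eLpNorm (fun x => f x * ‖x‖ ^ (-s / 2)) 2 volume

theorem aestronglyMeasurable_norm_rpow (s : ℝ) :
    AEStronglyMeasurable (fun x : EuclideanSpace ℝ (Fin N) => ‖x‖ ^ s) volume :=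
  (measurable_norm.pow_const s).aestronglyMeasurable

theorem aestronglyMeasurable_mul_norm_rpow (hf : AEStronglyMeasurable f volume) (s : ℝ) :
    AEStronglyMeasurable (fun x => f x * ‖x‖ ^ s) volume :=
  hf.mul (aestronglyMeasurable_norm_rpow s)

theorem sq_div_norm_rpow (s c : ℝ) (x : EuclideanSpace ℝ (Fin N)) :
    |c| ^ 2 / ‖x‖ ^ s = c ^ 2 * ‖x‖ ^ (-s) := by
  rw [sq_abs, Real.rpow_neg (norm_nonneg x), div_eq_mul_inv]

theorem weightedSq_eq_sq (s : ℝ) (f : EuclideanSpace ℝ (Fin N) → ℝ) :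
    weightedSq s f = weightedNorm s f ^ 2 := by
  have h := eLpNorm_nnreal_pow_eq_lintegral (p := 2) (μ := volume)
    (f := fun x : EuclideanSpace ℝ (Fin N) => f x * ‖x‖ ^ (-s / 2)) two_ne_zero
  simp only [NNReal.coe_ofNat, ENNReal.coe_ofNat, ENNReal.rpow_ofNat] at h
  rw [weightedNorm, h, weightedSq]
  refine lintegral_congr fun x => ?_
  rw [sq_div_norm_rpow, ← ofReal_norm, ← ENNReal.ofReal_pow (norm_nonneg _),
    Real.norm_eq_abs, sq_abs, mul_pow, ← Real.rpow_natCast (‖x‖ ^ (-s / 2)),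
    ← Real.rpow_mul (norm_nonneg x)]
  congr 3
  push_cast; ring

theorem weightedSq_rpow_half (s : ℝ) (f : EuclideanSpace ℝ (Fin N) → ℝ) :
    weightedSq s f ^ (1 / 2 : ℝ) = weightedNorm s f := by
  rw [weightedSq_eq_sq, ← ENNReal.rpow_natCast, ← ENNReal.rpow_mul]
  norm_num

theorem weightedSq_eq_ofReal (hf : Integrable (fun x => f x ^ 2 * ‖x‖ ^ (-s))) :
    weightedSq s f = ENNReal.ofReal (∫ x, f x ^ 2 * ‖x‖ ^ (-s)) := by
  rw [ofReal_integral_eq_lintegral_ofReal hf (ae_of_all _ fun x => by positivity), weightedSq]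
  simp_rw [sq_div_norm_rpow]

theorem weightedSq_ne_top_of_integrable (hf : Integrable (fun x => f x ^ 2 * ‖x‖ ^ (-s))) :
    weightedSq s f ≠ ⊤ := by
  rw [weightedSq_eq_ofReal hf]
  exact ENNReal.ofReal_ne_top

theorem weightedSq_congr_ae (h : f =ᵐ[volume] g) : weightedSq s f = weightedSq s g := by
  refine lintegral_congr_ae ?_
  filter_upwards [h] with x hx
  rw [hx]

theorem weightedSq_eq_zero_iff [NeZero N] (hf : AEStronglyMeasurable f volume) :
    weightedSq s f = 0 ↔ f =ᵐ[volume] 0 := by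
  rw [weightedSq_eq_sq, pow_eq_zero_iff two_ne_zero, weightedNorm,
    eLpNorm_eq_zero_iff (aestronglyMeasurable_mul_norm_rpow hf _) two_ne_zero]
  constructor <;> intro h
  · filter_upwards [h, ae_ne_zero] with x hx hx0
    have := (Real.rpow_pos_of_pos (norm_pos_iff.2 hx0) (-s / 2)).ne'
    simpa [this] using hx
  · filter_upwards [h] with x hx
    simp [hx]

theorem weightedNorm_add_le (hf : AEStronglyMeasurable f volume)
    (hg : AEStronglyMeasurable g volume) :
    weightedNorm s (fun x => f x + g x) ≤ weightedNorm s f + weightedNorm s g := by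
  have h := eLpNorm_add_le (aestronglyMeasurable_mul_norm_rpow hf (-s / 2))
    (aestronglyMeasurable_mul_norm_rpow hg (-s / 2)) (p := 2) one_le_two
  refine le_of_eq_of_le ?_ h
  simp only [weightedNorm, add_mul]
  rfl

theorem weightedNorm_sub_comm :
    weightedNorm s (fun x => f x - g x) = weightedNorm s (fun x => g x - f x) := by
  rw [weightedNorm, weightedNorm, ← eLpNorm_neg]
  congr 1
  funext x
  simp only [Pi.neg_apply]
  ring

theorem weightedNorm_le_add_sub (hf : AEStronglyMeasurable f volume)
    (hg : AEStronglyMeasurable g volume) :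
    weightedNorm s f ≤ weightedNorm s g + weightedNorm s (fun x => f x - g x) := by
  have := weightedNorm_add_le (s := s) (g := fun x => f x - g x) hg (hf.sub hg)
  simpa only [add_sub_cancel] using this

theorem weightedSq_add_le (hf : AEStronglyMeasurable f volume)
    (hg : AEStronglyMeasurable g volume) :
    weightedSq s (fun x => f x + g x) ≤ 2 * (weightedSq s f + weightedSq s g) := by
  simp_rw [weightedSq_eq_sq]
  refine (pow_le_pow_left₀ zero_le (weightedNorm_add_le hf hg) 2).trans ?_
  have := ENNReal.rpow_add_le_mul_rpow_add_rpow (weightedNorm s f) (weightedNorm s g)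
    (p := 2) one_le_two
  norm_num at this
  simpa using this

theorem tendsto_weightedNorm_of_weightedSq {φ : ℕ → EuclideanSpace ℝ (Fin N) → ℝ}
    (h : Tendsto (fun n => weightedSq s (φ n)) atTop (𝓝 0)) :
    Tendsto (fun n => weightedNorm s (φ n)) atTop (𝓝 0) := by
  have := (ENNReal.continuous_rpow_const (y := (1 / 2 : ℝ))).tendsto 0 |>.comp h
  rw [ENNReal.zero_rpow_of_pos (by norm_num)] at this
  simpa only [Function.comp_def, weightedSq_rpow_half] using this

/-- The triangle inequality in both directions squeezes the norms; finiteness of the limit makes the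
truncated subtraction of `ℝ≥0∞` continuous there. -/
theorem tendsto_weightedSq {φ : ℕ → EuclideanSpace ℝ (Fin N) → ℝ}
    (hφ : ∀ n, AEStronglyMeasurable (φ n) volume) (hu : AEStronglyMeasurable u volume)
    (hfin : weightedSq s u ≠ ⊤)
    (h : Tendsto (fun n => weightedSq s (fun x => φ n x - u x)) atTop (𝓝 0)) :
    Tendsto (fun n => weightedSq s (φ n)) atTop (𝓝 (weightedSq s u)) := by
  have hd := tendsto_weightedNorm_of_weightedSq h
  have hfin' : weightedNorm s u ≠ ⊤ := by
    rw [weightedSq_eq_sq] at hfin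
    exact fun h => hfin (by simp [h])
  simp_rw [weightedSq_eq_sq]
  refine ENNReal.Tendsto.pow ?_
  have hlow : Tendsto (fun n => weightedNorm s u - weightedNorm s (fun x => φ n x - u x)) atTop
      (𝓝 (weightedNorm s u)) := by
    simpa using ENNReal.Tendsto.sub tendsto_const_nhds hd (Or.inl hfin')
  have hupp : Tendsto (fun n => weightedNorm s u + weightedNorm s (fun x => φ n x - u x)) atTop
      (𝓝 (weightedNorm s u)) := by
    simpa using tendsto_const_nhds.add hd
  refine tendsto_of_tendsto_of_tendsto_of_le_of_le hlow hupp (fun n => ?_) fun n => ?_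
  · rw [tsub_le_iff_right, weightedNorm_sub_comm]
    exact weightedNorm_le_add_sub hu (hφ n)
  · exact weightedNorm_le_add_sub (hφ n) hu

/-- Fatou's lemma along weighted `L²` convergence, the weight on both sides being arbitrary. -/
theorem weightedSq_le_of_tendsto [NeZero N] {φ : ℕ → EuclideanSpace ℝ (Fin N) → ℝ} {s' : ℝ}
    (hφ : ∀ n, AEStronglyMeasurable (φ n) volume) (hu : AEStronglyMeasurable u volume)
    (h : Tendsto (fun n => weightedSq s (fun x => φ n x - u x)) atTop (𝓝 0))
    {c L : ℝ≥0∞} {B : ℕ → ℝ≥0∞} (hB : ∀ n, c * weightedSq s' (φ n) ≤ B n)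
    (hL : Tendsto B atTop (𝓝 L)) : c * weightedSq s' u ≤ L := by
  have hm : TendstoInMeasure volume (fun n x => φ n x * ‖x‖ ^ (-s / 2)) atTop
      (fun x => u x * ‖x‖ ^ (-s / 2)) := by
    refine tendstoInMeasure_of_tendsto_eLpNorm two_ne_zero
      (fun n => (hφ n).mul (aestronglyMeasurable_norm_rpow _))
      (hu.mul (aestronglyMeasurable_norm_rpow _)) ?_
    convert tendsto_weightedNorm_of_weightedSq h using 3
    simp only [weightedNorm]
    congr 1
    funext x
    simp [sub_mul]
  -- An almost everywhere convergent subsequence no longer depends on the weight, so Fatou applies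
  -- with the other exponent `s'`.
  obtain ⟨ns, hns, hae⟩ := hm.exists_seq_tendsto_ae
  have hF : weightedSq s' u ≤ liminf (fun k => weightedSq s' (φ (ns k))) atTop := by
    refine le_trans (lintegral_mono_ae ?_) (lintegral_liminf_le' fun k => ?_)
    · filter_upwards [hae, ae_ne_zero] with x hx hx0
      have hpos := Real.rpow_pos_of_pos (norm_pos_iff.2 hx0) (-s / 2)
      have h1 : Tendsto (fun k => φ (ns k) x) atTop (𝓝 (u x)) := by
        have := hx.mul_const (‖x‖ ^ (-s / 2))⁻¹
        simpa [mul_assoc, hpos.ne'] using this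
      refine le_of_eq (Tendsto.liminf_eq ?_).symm
      exact (ENNReal.continuous_ofReal.tendsto _).comp (((h1.abs).pow 2).div_const _)
    · simp_rw [sq_div_norm_rpow]
      exact (((hφ _).pow 2).mul (aestronglyMeasurable_norm_rpow _)).aemeasurable.ennreal_ofReal
  calc c * weightedSq s' u ≤ c * liminf (fun k => weightedSq s' (φ (ns k))) atTop := by gcongr
    _ ≤ liminf (fun k => c * weightedSq s' (φ (ns k))) atTop := by
      rw [liminf_eq_iSup_iInf_of_nat, liminf_eq_iSup_iInf_of_nat, ENNReal.mul_iSup]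
      refine iSup_mono fun i => le_iInf₂ fun j hj => ?_
      gcongr
      exact iInf₂_le j hj
    _ ≤ liminf (fun k => B (ns k)) atTop := liminf_le_liminf (Eventually.of_forall fun k => hB _)
    _ = L := (hL.comp hns.tendsto_atTop).liminf_eq

theorem integrable_sq_mul_norm_rpow (hf : Continuous f) (hc : HasCompactSupport f)
    (h0 : (0 : EuclideanSpace ℝ (Fin N)) ∉ tsupport f) (s : ℝ) :
    Integrable (fun x => f x ^ 2 * ‖x‖ ^ s) := by
  have := integrable_mul_of_zero_notMem_tsupport hf hc h0
    (hf.continuousOn.mul (continuousOn_norm_rpow s))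
  simpa [sq, mul_assoc] using this

theorem CKNTest.integrable_sq (hu : CKNTest u) (s : ℝ) :
    Integrable (fun x => u x ^ 2 * ‖x‖ ^ s) :=
  integrable_sq_mul_norm_rpow hu.1.continuous hu.2.1 hu.2.2 s

theorem CKNTest.integrable_xDotGrad_sq (hu : CKNTest u) (s : ℝ) :
    Integrable (fun x => xDotGrad u x ^ 2 * ‖x‖ ^ s) :=
  integrable_sq_mul_norm_rpow hu.contDiff_one.continuous_xDotGrad hu.2.1.xDotGrad
    hu.zero_notMem_xDotGrad s

theorem CKNTest.weightedSq_ne_top (hu : CKNTest u) (s : ℝ) : weightedSq s u ≠ ⊤ :=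
  weightedSq_ne_top_of_integrable (hu.integrable_sq _)

theorem CKNTest.weightedSq_xDotGrad_ne_top (hu : CKNTest u) (s : ℝ) :
    weightedSq s (xDotGrad u) ≠ ⊤ :=
  weightedSq_ne_top_of_integrable (hu.integrable_xDotGrad_sq _)

theorem CKNTest.aestronglyMeasurable (hu : CKNTest u) : AEStronglyMeasurable u volume :=
  hu.1.continuous.aestronglyMeasurable

theorem CKNTest.aestronglyMeasurable_xDotGrad (hu : CKNTest u) :
    AEStronglyMeasurable (_root_.xDotGrad u) volume :=
  hu.contDiff_one.continuous_xDotGrad.aestronglyMeasurable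

theorem weightedSq_ne_top_of_sub (hf : AEStronglyMeasurable f volume)
    (hg : AEStronglyMeasurable g volume) (h : weightedSq s (fun x => f x - g x) ≠ ⊤)
    (hf' : weightedSq s f ≠ ⊤) : weightedSq s g ≠ ⊤ := by
  rw [weightedSq_eq_sq] at *
  have h1 := weightedNorm_le_add_sub (s := s) hg hf
  rw [weightedNorm_sub_comm] at h1
  have h2 : weightedNorm s f ≠ ⊤ := fun h => hf' (by simp [h])
  have h3 : weightedNorm s (fun x => f x - g x) ≠ ⊤ := fun h' => h (by simp [h'])
  exact ENNReal.pow_ne_top (ne_top_of_le_ne_top (ENNReal.add_ne_top.2 ⟨h2, h3⟩) h1)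

theorem MemCKNSpace.exists_seq {G : EuclideanSpace ℝ (Fin N) → ℝ} (h : MemCKNSpace a b u G) :
    weightedSq (2 * a) u ≠ ⊤ ∧ weightedSq (2 * b + 2) G ≠ ⊤ ∧
    ∃ φ : ℕ → EuclideanSpace ℝ (Fin N) → ℝ, (∀ n, CKNTest (φ n)) ∧
      Tendsto (fun n => weightedSq (2 * a) (fun x => φ n x - u x)) atTop (𝓝 0) ∧
      Tendsto (fun n => weightedSq (2 * a) (φ n)) atTop (𝓝 (weightedSq (2 * a) u)) ∧
      Tendsto (fun n => weightedSq (2 * b + 2) (xDotGrad (φ n))) atTop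
        (𝓝 (weightedSq (2 * b + 2) G)) := by
  obtain ⟨hu, hG, φ, hφ, hlim⟩ := h
  have h1 : Tendsto (fun n => weightedSq (2 * a) (fun x => φ n x - u x)) atTop (𝓝 0) :=
    tendsto_of_tendsto_of_tendsto_of_le_of_le tendsto_const_nhds hlim (fun _ => zero_le)
      fun _ => le_add_self
  have h2 : Tendsto (fun n => weightedSq (2 * b + 2) (fun x => xDotGrad (φ n) x - G x)) atTop
      (𝓝 0) :=
    tendsto_of_tendsto_of_tendsto_of_le_of_le tendsto_const_nhds hlim (fun _ => zero_le)
      fun _ => le_self_add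
  obtain ⟨n, hn1, hn2⟩ := ((h1.eventually_lt_const ENNReal.zero_lt_top).and
    (h2.eventually_lt_const ENNReal.zero_lt_top)).exists
  have hut := weightedSq_ne_top_of_sub (hφ n).aestronglyMeasurable hu hn1.ne
    ((hφ n).weightedSq_ne_top _)
  have hGt := weightedSq_ne_top_of_sub (hφ n).aestronglyMeasurable_xDotGrad hG hn2.ne
    ((hφ n).weightedSq_xDotGrad_ne_top _)
  exact ⟨hut, hGt, φ, hφ, h1,
    tendsto_weightedSq (fun n => (hφ n).aestronglyMeasurable) hu hut h1,
    tendsto_weightedSq (fun n => (hφ n).aestronglyMeasurable_xDotGrad) hG hGt h2⟩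

theorem CKNTest.memCKNSpace (hu : CKNTest u) : MemCKNSpace a b u (_root_.xDotGrad u) :=
  ⟨hu.aestronglyMeasurable, hu.aestronglyMeasurable_xDotGrad, fun _ => u, fun _ => hu, by
    simp [weightedSq]⟩

theorem CKNTest.ae_eq_zero_iff (hu : CKNTest u) : u =ᵐ[volume] 0 ↔ u = 0 := by
  refine ⟨fun h => ?_, fun h => h ▸ ae_eq_rfl⟩
  exact (hu.1.continuous.ae_eq_iff_eq volume continuous_zero).1 h

theorem CKNTest.weightedSq_ne_zero [NeZero N] (hu : CKNTest u) (h : u ≠ 0) (s : ℝ) :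
    weightedSq s u ≠ 0 := by
  rwa [Ne, weightedSq_eq_zero_iff hu.aestronglyMeasurable, hu.ae_eq_zero_iff]

/-! ### The quotient, the inequality, and the infimum over the completion. -/

theorem cknQuotient_eq (u g : EuclideanSpace ℝ (Fin N) → ℝ) :
    cknQuotient a b u g =
      weightedNorm (2 * a) u * weightedNorm (2 * b + 2) g / weightedSq (a + b + 1) u := by
  simp [cknQuotient, ← weightedSq_rpow_half]

/-- For elements of the completion the denominator is not known to be finite; a finite numerator is
enough to clear it. -/
theorem le_cknQuotient_iff {c : ℝ≥0∞} (h0 : weightedSq (a + b + 1) u ≠ 0)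
    (h1 : weightedSq (2 * a) u ≠ ⊤) (h2 : weightedSq (2 * b + 2) g ≠ ⊤) :
    c ≤ cknQuotient a b u g ↔ c * weightedSq (a + b + 1) u ≤
      weightedNorm (2 * a) u * weightedNorm (2 * b + 2) g := by
  rw [cknQuotient_eq]
  rw [weightedSq_eq_sq] at h1 h2
  refine ENNReal.le_div_iff_mul_le (Or.inl h0) (Or.inr (ENNReal.mul_ne_top ?_ ?_))
  · exact fun h => h1 (by simp [h])
  · exact fun h => h2 (by simp [h])

theorem CKNTest.le_cknQuotient_iff_cknIneq [NeZero N] (hu : CKNTest u) (h : u ≠ 0) {c : ℝ≥0∞} :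
    c ≤ cknQuotient a b u (_root_.xDotGrad u) ↔ CKNIneq a b c u := by
  rw [le_cknQuotient_iff (hu.weightedSq_ne_zero h _) (hu.weightedSq_ne_top _)
    (hu.weightedSq_xDotGrad_ne_top _), CKNIneq, weightedSq_eq_sq (2 * a),
    weightedSq_eq_sq (2 * b + 2), ← mul_pow, ← mul_pow, ENNReal.pow_le_pow_left_iff two_ne_zero]

theorem le_cknConst_iff [NeZero N] {c : ℝ≥0∞} :
    c ≤ cknConst N a b ↔ ∀ u : EuclideanSpace ℝ (Fin N) → ℝ, CKNTest u → CKNIneq a b c u := by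
  simp only [cknConst, le_iInf_iff]
  refine forall₂_congr fun u hu => ⟨fun h => ?_, fun h h0 => ?_⟩
  · by_cases h0 : u = 0
    · subst h0
      simp [CKNIneq, weightedSq]
    · exact (hu.le_cknQuotient_iff_cknIneq h0).1 (h h0)
  · exact (hu.le_cknQuotient_iff_cknIneq h0).2 h

theorem isGreatest_cknConst [NeZero N] (a b : ℝ) :
    IsGreatest {C : ℝ≥0∞ | ∀ u : EuclideanSpace ℝ (Fin N) → ℝ, CKNTest u → CKNIneq a b C u}
      (cknConst N a b) :=
  ⟨le_cknConst_iff.1 le_rfl, fun _ hC => le_cknConst_iff.2 hC⟩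

/-- Both factors of the numerator converge along the approximating test functions. The weight
|x|^{-(a+b+1)} is not part of the norm, but lower semicontinuity of that integral is the direction
required. -/
theorem cknConst_le_cknQuotient [NeZero N] {G : EuclideanSpace ℝ (Fin N) → ℝ}
    (h : MemCKNSpace a b u G) (h0 : ¬ u =ᵐ[volume] 0) :
    cknConst N a b ≤ cknQuotient a b u G := by
  obtain ⟨h1, h2, φ, hφ, hsub, hlim1, hlim2⟩ := h.exists_seq
  rw [le_cknQuotient_iff (by rwa [Ne, weightedSq_eq_zero_iff h.1]) h1 h2]
  refine weightedSq_le_of_tendsto (fun n => (hφ n).aestronglyMeasurable) h.1 hsub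
    (B := fun n => weightedNorm (2 * a) (φ n) * weightedNorm (2 * b + 2) (xDotGrad (φ n)))
    (fun n => ?_) ?_
  · have := (le_cknConst_iff (a := a) (b := b)).1 le_rfl (φ n) (hφ n)
    rwa [CKNIneq, weightedSq_eq_sq (2 * a), weightedSq_eq_sq (2 * b + 2), ← mul_pow, ← mul_pow,
      ENNReal.pow_le_pow_left_iff two_ne_zero] at this
  · simp_rw [← weightedSq_rpow_half]
    refine ENNReal.Tendsto.mul (hlim1.ennrpow_const _) (Or.inr ?_) (hlim2.ennrpow_const _)
      (Or.inr ?_)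
    · exact ENNReal.rpow_ne_top_of_nonneg (by norm_num) h2
    · exact ENNReal.rpow_ne_top_of_nonneg (by norm_num) h1

theorem cknConst_eq_cknConstCompletion [NeZero N] (a b : ℝ) :
    cknConst N a b = cknConstCompletion N a b := by
  refine le_antisymm ?_ ?_
  · simp only [cknConstCompletion, le_iInf_iff]
    exact fun u G h h0 => cknConst_le_cknQuotient h h0
  · simp only [cknConst, le_iInf_iff]
    exact fun u hu h0 => iInf₂_le_of_le u (xDotGrad u)
      (iInf₂_le_of_le hu.memCKNSpace (mt hu.ae_eq_zero_iff.1 h0) le_rfl)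

end WeightedNorm

/-! ### A criterion for membership in the completion. -/

section Approximation

variable {N : ℕ} {u f g : EuclideanSpace ℝ (Fin N) → ℝ} {a b s : ℝ}

theorem weightedSq_le_of_bound {K : Set (EuclideanSpace ℝ (Fin N))} (hK : MeasurableSet K)
    {η : ℝ} (hg : ∀ x, |g x| ≤ η) (hs : ∀ x ∉ K, g x = 0) :
    weightedSq s g ≤ ENNReal.ofReal (η ^ 2) * ∫⁻ x in K, ENNReal.ofReal (‖x‖ ^ (-s)) := by
  rw [← lintegral_const_mul' _ _ ENNReal.ofReal_ne_top, ← lintegral_indicator hK, weightedSq]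
  refine lintegral_mono fun x => ?_
  by_cases hx : x ∈ K
  · rw [indicator_of_mem hx, sq_div_norm_rpow, ← ENNReal.ofReal_mul (sq_nonneg _)]
    exact ENNReal.ofReal_le_ofReal (mul_le_mul_of_nonneg_right
      (sq_le_sq.2 ((hg x).trans (le_abs_self η))) (by positivity))
  · simp [hs x hx]

theorem lintegral_norm_rpow_ne_top {K : Set (EuclideanSpace ℝ (Fin N))} (hK : IsCompact K)
    (h0 : K ⊆ {0}ᶜ) (s : ℝ) : ∫⁻ x in K, ENNReal.ofReal (‖x‖ ^ s) ≠ ⊤ := by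
  have hi : IntegrableOn (fun x : EuclideanSpace ℝ (Fin N) => ‖x‖ ^ s) K :=
    ((continuousOn_norm_rpow s).mono h0).integrableOn_compact hK
  exact hi.lintegral_lt_top.ne

/-- Mollification: both `f` and its derivative are uniformly continuous, and convolution commutes
with differentiation. Keeping the support in a fixed compact set away from 0 makes all weights
bounded there. -/
theorem exists_ckntest_uniform_approx (hf : ContDiff ℝ 1 f) (hc : HasCompactSupport f)
    {δ₀ : ℝ} (hδ₀ : 0 < δ₀) (h0 : Metric.cthickening δ₀ (tsupport f) ⊆ {0}ᶜ) {η : ℝ} (hη : 0 < η) :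
    ∃ φ : EuclideanSpace ℝ (Fin N) → ℝ, CKNTest φ ∧
      tsupport φ ⊆ Metric.cthickening δ₀ (tsupport f) ∧
      (∀ x, |φ x - f x| ≤ η) ∧ ∀ x, ‖fderiv ℝ φ x - fderiv ℝ f x‖ ≤ η := by
  have hcf' := hf.continuous_fderiv one_ne_zero
  have huf := Metric.uniformContinuous_iff.1 (hc.uniformContinuous_of_continuous hf.continuous) η hη
  have huf' := Metric.uniformContinuous_iff.1
    ((hc.fderiv ℝ).uniformContinuous_of_continuous hcf') η hη
  obtain ⟨δ₁, hδ₁, h1⟩ := huf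
  obtain ⟨δ₂, hδ₂, h2⟩ := huf'
  have hδ : 0 < min δ₀ (min δ₁ δ₂) := lt_min hδ₀ (lt_min hδ₁ hδ₂)
  -- The outer radius respects the allowed thickening `δ₀` and the moduli of continuity `δ₁`, `δ₂`
  -- of `f` and its derivative.
  let ψ : ContDiffBump (0 : EuclideanSpace ℝ (Fin N)) :=
    ⟨min δ₀ (min δ₁ δ₂) / 2, min δ₀ (min δ₁ δ₂), by positivity, by linarith⟩
  let φ : EuclideanSpace ℝ (Fin N) → ℝ :=
    convolution (ψ.normed volume) f (ContinuousLinearMap.lsmul ℝ ℝ) volume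
  have hψi : LocallyIntegrable (ψ.normed volume) volume :=
    ψ.continuous_normed.locallyIntegrable
  have hder (x) : HasFDerivAt φ (convolution (ψ.normed volume) (fderiv ℝ f)
      (ContinuousLinearMap.lsmul ℝ ℝ) volume x) x := by
    have h := hc.hasFDerivAt_convolution_right (ContinuousLinearMap.lsmul ℝ ℝ) hψi hf x
    refine h.congr_fderiv ?_
    simp only [convolution]
    refine integral_congr_ae (ae_of_all _ fun y => ?_)
    ext z
    simp
  have hsupp : tsupport φ ⊆ Metric.cthickening δ₀ (tsupport f) := by
    refine closure_minimal (fun x hx => ?_) Metric.isClosed_cthickening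
    obtain ⟨y, hy, z, hz, rfl⟩ := support_convolution_subset _ hx
    rw [ψ.support_normed_eq] at hy
    refine Metric.mem_cthickening_of_dist_le _ z _ _ (subset_tsupport _ hz) ?_
    have : ‖y‖ < ψ.rOut := by simpa using hy
    simpa [dist_eq_norm] using this.le.trans (min_le_left _ _)
  refine ⟨φ, ⟨?_, ?_, fun h => h0 (hsupp h) rfl⟩, hsupp, fun x => ?_, fun x => ?_⟩
  · exact ψ.hasCompactSupport_normed.contDiff_convolution_left _ ψ.contDiff_normed
      hf.continuous.locallyIntegrable
  · exact (hc.isCompact.cthickening (r := δ₀)).of_isClosed_subset (isClosed_tsupport _) hsupp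
  · rw [← Real.dist_eq]
    refine ContDiffBump.dist_normed_convolution_le hf.continuous.aestronglyMeasurable fun y hy => ?_
    exact (h1 (lt_of_lt_of_le hy ((min_le_right _ _).trans (min_le_left _ _)))).le
  · rw [(hder x).fderiv, ← dist_eq_norm]
    refine ContDiffBump.dist_normed_convolution_le hcf'.aestronglyMeasurable fun y hy => ?_
    exact (h2 (lt_of_lt_of_le hy ((min_le_right _ _).trans (min_le_right _ _)))).le

theorem exists_ckntest_approx (hf : ContDiff ℝ 1 f) (hc : HasCompactSupport f)
    (h0 : (0 : EuclideanSpace ℝ (Fin N)) ∉ tsupport f) (a b : ℝ) {ε : ℝ≥0∞} (hε : 0 < ε) :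
    ∃ φ : EuclideanSpace ℝ (Fin N) → ℝ, CKNTest φ ∧
      weightedSq (2 * b + 2) (fun x => xDotGrad φ x - xDotGrad f x)
        + weightedSq (2 * a) (fun x => φ x - f x) < ε := by
  obtain ⟨δ₀, hδ₀, hδ⟩ := hc.isCompact.exists_cthickening_subset_open
    (isOpen_compl_singleton (x := (0 : EuclideanSpace ℝ (Fin N))))
    (fun x hx => by rintro rfl; exact h0 hx)
  set K := Metric.cthickening δ₀ (tsupport f) with hKdef
  have hK : IsCompact K := hc.isCompact.cthickening
  have hKm : MeasurableSet K := hK.isClosed.measurableSet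
  obtain ⟨R, hR0, hR⟩ : ∃ R, 0 ≤ R ∧ ∀ x ∈ K, ‖x‖ ≤ R := by
    obtain ⟨R, hR⟩ := hK.isBounded.exists_norm_le
    exact ⟨|R|, abs_nonneg R, fun x hx => (hR x hx).trans (le_abs_self R)⟩
  have hsubK : tsupport f ⊆ K := Metric.self_subset_cthickening _
  set J₁ := ∫⁻ x in K, ENNReal.ofReal (‖x‖ ^ (-(2 * b + 2)))
  set J₂ := ∫⁻ x in K, ENNReal.ofReal (‖x‖ ^ (-(2 * a)))
  have hJ₁ : J₁ ≠ ⊤ := lintegral_norm_rpow_ne_top hK hδ _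
  have hJ₂ : J₂ ≠ ⊤ := lintegral_norm_rpow_ne_top hK hδ _
  have hlim : Tendsto (fun η : ℝ => ENNReal.ofReal ((η * R) ^ 2) * J₁ + ENNReal.ofReal (η ^ 2) * J₂)
      (𝓝[>] 0) (𝓝 0) := by
    have hA : Tendsto (fun η : ℝ => ENNReal.ofReal ((η * R) ^ 2)) (𝓝[>] 0) (𝓝 0) := by
      have : Continuous fun η : ℝ => ENNReal.ofReal ((η * R) ^ 2) :=
        ENNReal.continuous_ofReal.comp (by fun_prop)
      simpa using (this.tendsto 0).mono_left nhdsWithin_le_nhds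
    have hB : Tendsto (fun η : ℝ => ENNReal.ofReal (η ^ 2)) (𝓝[>] 0) (𝓝 0) := by
      have : Continuous fun η : ℝ => ENNReal.ofReal (η ^ 2) :=
        ENNReal.continuous_ofReal.comp (by fun_prop)
      simpa using (this.tendsto 0).mono_left nhdsWithin_le_nhds
    simpa using (ENNReal.Tendsto.mul_const hA (Or.inr hJ₁)).add
      (ENNReal.Tendsto.mul_const hB (Or.inr hJ₂))
  obtain ⟨η, hη, hηpos⟩ := ((hlim.eventually_lt_const hε).and self_mem_nhdsWithin).exists
  obtain ⟨φ, hφ, hφs, hφ1, hφ2⟩ := exists_ckntest_uniform_approx hf hc hδ₀ hδ hηpos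
  refine ⟨φ, hφ, lt_of_le_of_lt (add_le_add ?_ ?_) hη⟩
  · have hz : ∀ x ∉ K, xDotGrad φ x - xDotGrad f x = 0 := fun x hx => by
      rw [image_eq_zero_of_notMem_tsupport fun h => hx (hφs (tsupport_xDotGrad_subset h)),
        image_eq_zero_of_notMem_tsupport fun h => hx (hsubK (tsupport_xDotGrad_subset h)), sub_zero]
    refine weightedSq_le_of_bound hKm (fun x => ?_) hz
    by_cases hx : x ∈ K
    · have h1 : xDotGrad φ x - xDotGrad f x = (fderiv ℝ φ x - fderiv ℝ f x) x := by
        simp [xDotGrad]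
      rw [h1, ← Real.norm_eq_abs]
      refine (ContinuousLinearMap.le_opNorm _ _).trans ?_
      exact mul_le_mul (hφ2 x) (hR x hx) (norm_nonneg _) (le_of_lt hηpos)
    · rw [hz x hx, abs_zero]
      exact mul_nonneg (le_of_lt hηpos) hR0
  · refine weightedSq_le_of_bound hKm hφ1 fun x hx => ?_
    rw [image_eq_zero_of_notMem_tsupport fun h => hx (hφs h),
      image_eq_zero_of_notMem_tsupport fun h => hx (hsubK h), sub_zero]

theorem memCKNSpace_of_approx {G : EuclideanSpace ℝ (Fin N) → ℝ}
    (hu : AEStronglyMeasurable u volume) (hG : AEStronglyMeasurable G volume)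
    (h : ∀ ε : ℝ≥0∞, 0 < ε → ∃ φ : EuclideanSpace ℝ (Fin N) → ℝ, CKNTest φ ∧
      weightedSq (2 * b + 2) (fun x => xDotGrad φ x - G x)
        + weightedSq (2 * a) (fun x => φ x - u x) < ε) : MemCKNSpace a b u G := by
  choose φ hφ hlt using fun n : ℕ => h ((n : ℝ≥0∞)⁻¹) (by simp)
  exact ⟨hu, hG, φ, hφ, tendsto_of_tendsto_of_tendsto_of_le_of_le tendsto_const_nhds
    ENNReal.tendsto_inv_nat_nhds_zero (fun _ => zero_le) fun n => (hlt n).le⟩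

theorem tendsto_weightedSq_logCutoff_mul_sub [NeZero N] (hf : AEStronglyMeasurable f volume)
    (hfin : weightedSq s f ≠ ⊤) :
    Tendsto (fun n => weightedSq s (fun x => logCutoff N n x * f x - f x)) atTop (𝓝 0) := by
  have hz : (∫⁻ _ : EuclideanSpace ℝ (Fin N), (0 : ℝ≥0∞)) = 0 := lintegral_zero
  rw [← hz]
  refine tendsto_lintegral_of_dominated_convergence'
    (fun x => ENNReal.ofReal (|f x| ^ 2 / ‖x‖ ^ s)) (fun n => ?_) (fun n => ae_of_all _ fun x => ?_)
    hfin ?_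
  · simp_rw [sq_div_norm_rpow]
    exact (((((ckntest_logCutoff n).aestronglyMeasurable.mul hf).sub hf).pow 2).mul
      (aestronglyMeasurable_norm_rpow _)).aemeasurable.ennreal_ofReal
  · refine ENNReal.ofReal_le_ofReal (div_le_div_of_nonneg_right
      (pow_le_pow_left₀ (abs_nonneg _) ?_ 2) (by positivity))
    change |logCutoff N n x * f x - f x| ≤ |f x|
    rw [show logCutoff N n x * f x - f x = -((1 - logCutoff N n x) * f x) by ring, abs_neg, abs_mul,
      abs_of_nonneg (sub_nonneg.2 (logCutoff_le_one n x))]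
    exact mul_le_of_le_one_left (abs_nonneg _) (by linarith [logCutoff_nonneg n x])
  · filter_upwards [ae_ne_zero] with x hx
    have h1 : Tendsto (fun n => logCutoff N n x * f x - f x) atTop (𝓝 0) := by
      simpa using ((tendsto_logCutoff hx).mul_const (f x)).sub_const (f x)
    have h2 := (ENNReal.continuous_ofReal.tendsto _).comp (((h1.abs).pow 2).div_const (‖x‖ ^ s))
    simpa [Function.comp_def] using h2

theorem ContinuousOn.aestronglyMeasurable_of_compl_zero [NeZero N] (hf : ContinuousOn f {0}ᶜ) :
    AEStronglyMeasurable f volume := by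
  have := hf.aestronglyMeasurable (μ := volume)
    (measurableSet_singleton (0 : EuclideanSpace ℝ (Fin N))).compl
  rwa [restrict_compl_singleton] at this

/-- The integrand is at most B (M/(n+1))² |x|^{-N} on an annulus of logarithmic length 4(n+1), so
the integral is O(1/n). Mere boundedness of u²|x|^{N-s} suffices, which covers b = (N-2)/2, where
u²|x|^{-s} may fail to be integrable. -/
theorem tendsto_weightedSq_mul_xDotGrad_logCutoff [NeZero N] {B : ℝ}
    (hB : ∀ x, x ≠ 0 → u x ^ 2 * ‖x‖ ^ ((N : ℝ) - s) ≤ B) :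
    Tendsto (fun n => weightedSq s (fun x => u x * xDotGrad (logCutoff N n) x)) atTop (𝓝 0) := by
  obtain ⟨M, hM0, hM⟩ := exists_abs_xDotGrad_logCutoff_le N
  set A := (N : ℝ) * volume.real (Metric.ball (0 : EuclideanSpace ℝ (Fin N)) 1)
  have hlim : Tendsto (fun n : ℕ => ENNReal.ofReal (4 * B * M ^ 2 * A * (1 / ((n : ℝ) + 1))))
      atTop (𝓝 0) := by
    have := (tendsto_one_div_add_atTop_nhds_zero_nat (𝕜 := ℝ)).const_mul (4 * B * M ^ 2 * A)
    simpa [Function.comp_def] using (ENNReal.continuous_ofReal.tendsto _).comp this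
  refine tendsto_of_tendsto_of_tendsto_of_le_of_le tendsto_const_nhds hlim (fun _ => zero_le)
    fun n => ?_
  have hn : (0 : ℝ) < n + 1 := by positivity
  have hm : MeasurableSet (logAnnulus N (2 * ((n : ℝ) + 1))) :=
    (isCompact_logAnnulus _).isClosed.measurableSet
  have hi : IntegrableOn (fun x : EuclideanSpace ℝ (Fin N) =>
      B * (M / (n + 1)) ^ 2 * ‖x‖ ^ (-(N : ℝ))) (logAnnulus N (2 * ((n : ℝ) + 1))) :=
    (integrableOn_logAnnulus (continuousOn_norm_rpow _) _).const_mul _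
  have hval : ∫ x in logAnnulus N (2 * ((n : ℝ) + 1)), B * (M / (n + 1)) ^ 2 * ‖x‖ ^ (-(N : ℝ))
      = 4 * B * M ^ 2 * A * (1 / ((n : ℝ) + 1)) := by
    rw [integral_const_mul, setIntegral_logAnnulus_norm_rpow (by positivity)]
    field_simp
    ring
  have hBpos : ∀ x : EuclideanSpace ℝ (Fin N), x ≠ 0 → 0 ≤ B := fun x hx =>
    le_trans (by positivity) (hB x hx)
  rw [← hval, ofReal_integral_eq_lintegral_ofReal hi
    ((ae_restrict_iff' hm).2 (ae_of_all _ fun x hx => by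
      have := hBpos x (logAnnulus_subset _ hx)
      simp only [Pi.zero_apply]
      positivity)), ← lintegral_indicator hm, weightedSq]
  refine lintegral_mono fun x => ?_
  by_cases hx : x ∈ logAnnulus N (2 * ((n : ℝ) + 1))
  · rw [indicator_of_mem hx, sq_div_norm_rpow]
    refine ENNReal.ofReal_le_ofReal ?_
    have hx0 : x ≠ 0 := logAnnulus_subset _ hx
    have hxp := norm_pos_iff.2 hx0
    have h1 : xDotGrad (logCutoff N n) x ^ 2 ≤ (M / (n + 1)) ^ 2 :=
      sq_le_sq.2 ((hM n x).trans (le_abs_self _))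
    have h2 : ‖x‖ ^ (-s) = ‖x‖ ^ ((N : ℝ) - s) * ‖x‖ ^ (-(N : ℝ)) := by
      rw [← Real.rpow_add hxp]; congr 1; ring
    calc (u x * xDotGrad (logCutoff N n) x) ^ 2 * ‖x‖ ^ (-s)
        = (u x ^ 2 * ‖x‖ ^ ((N : ℝ) - s)) * xDotGrad (logCutoff N n) x ^ 2 * ‖x‖ ^ (-(N : ℝ)) := by
          rw [h2]; ring
      _ ≤ B * (M / (n + 1)) ^ 2 * ‖x‖ ^ (-(N : ℝ)) := by
          have := hBpos x hx0
          gcongr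
          exact hB x hx0
  · have : xDotGrad (logCutoff N n) x = 0 := image_eq_zero_of_notMem_tsupport fun h =>
      hx (tsupport_logCutoff_subset n (tsupport_xDotGrad_subset h))
    simp [this]

/-- A function that is `C¹` off the origin, with finite norm and at most logarithmically critical
growth, belongs to the completion. -/
theorem memCKNSpace_of_contDiffOn [NeZero N] (hu : ContDiffOn ℝ 1 u {0}ᶜ) {B : ℝ}
    (hB : ∀ x, x ≠ 0 → u x ^ 2 * ‖x‖ ^ ((N : ℝ) - (2 * b + 2)) ≤ B)
    (h1 : weightedSq (2 * a) u ≠ ⊤) (h2 : weightedSq (2 * b + 2) (xDotGrad u) ≠ ⊤) :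
    MemCKNSpace a b u (xDotGrad u) := by
  have hum := ContinuousOn.aestronglyMeasurable_of_compl_zero hu.continuousOn
  have hGm := ContinuousOn.aestronglyMeasurable_of_compl_zero hu.continuousOn_xDotGrad
  refine memCKNSpace_of_approx hum hGm fun ε hε => ?_
  have hc (n : ℕ) := (ckntest_logCutoff (N := N) n).contDiff_one
  -- The factor 2 comes from one use of `weightedSq_add_le` and 4 from two nested uses:
  -- mollification error against cutoff error, then the two terms of the product rule.
  have hlim := (ENNReal.Tendsto.const_mul ((tendsto_weightedSq_logCutoff_mul_sub hGm h2).add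
    (tendsto_weightedSq_mul_xDotGrad_logCutoff hB)) (a := 4) (by simp)).add
    (ENNReal.Tendsto.const_mul (tendsto_weightedSq_logCutoff_mul_sub hum h1) (a := 2) (by simp))
  simp only [add_zero, mul_zero] at hlim
  obtain ⟨n, hn⟩ := (hlim.eventually_lt_const hε).exists
  -- The slack `r` pays for the mollification, which is made with error below `r / 2` because
  -- `weightedSq_add_le` doubles it.
  obtain ⟨r, hr, hlt⟩ := ENNReal.lt_iff_exists_add_pos_lt.1 hn
  have hv : ContDiff ℝ 1 (fun x => logCutoff N n x * u x) :=
    contDiff_mul_of_zero_notMem_tsupport (hc n) (ckntest_logCutoff n).2.2 hu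
  obtain ⟨φ, hφ, hφr⟩ := exists_ckntest_approx hv (ckntest_logCutoff n).2.1.mul_right
    (zero_notMem_tsupport_mul (ckntest_logCutoff n).2.2) a b
    (ε := r / 2) (ENNReal.half_pos (by exact_mod_cast hr.ne'))
  refine ⟨φ, hφ, lt_of_le_of_lt ?_ hlt⟩
  have hvm := hv.continuous.aestronglyMeasurable (μ := volume)
  have hvm' := hv.continuous_xDotGrad.aestronglyMeasurable (μ := volume)
  have e1 := weightedSq_add_le (s := 2 * a) (f := fun x => φ x - logCutoff N n x * u x)
    (g := fun x => logCutoff N n x * u x - u x) (hφ.aestronglyMeasurable.sub hvm) (hvm.sub hum)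
  have e2 := weightedSq_add_le (s := 2 * b + 2)
    (f := fun x => xDotGrad φ x - xDotGrad (fun x => logCutoff N n x * u x) x)
    (g := fun x => xDotGrad (fun x => logCutoff N n x * u x) x - xDotGrad u x)
    (hφ.aestronglyMeasurable_xDotGrad.sub hvm') (hvm'.sub hGm)
  have e3 := weightedSq_add_le (s := 2 * b + 2)
    (f := fun x => logCutoff N n x * xDotGrad u x - xDotGrad u x)
    (g := fun x => u x * xDotGrad (logCutoff N n) x)
    (((hc n).continuous.aestronglyMeasurable.mul hGm).sub hGm)
    (hum.mul (hc n).continuous_xDotGrad.aestronglyMeasurable)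
  have hid : (fun x => xDotGrad (fun x => logCutoff N n x * u x) x - xDotGrad u x)
      = fun x => (logCutoff N n x * xDotGrad u x - xDotGrad u x)
        + u x * xDotGrad (logCutoff N n) x := by
    funext x
    rw [xDotGrad_mul_of_contDiffOn (hc n) hu]
    ring
  rw [← hid] at e3
  simp only [sub_add_sub_cancel] at e1 e2
  refine (add_le_add (e2.trans (mul_le_mul_right (add_le_add_right e3 _) 2)) e1).trans ?_
  have e4 := mul_le_mul_right hφr.le 2
  rw [ENNReal.mul_div_cancel two_ne_zero ENNReal.ofNat_ne_top] at e4
  refine le_trans (le_of_eq ?_) (add_le_add_right e4 _)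
  ring

end Approximation

/-! ### The lower bound by Cauchy-Schwarz. -/

section LowerBound

variable {N : ℕ} {u f g : EuclideanSpace ℝ (Fin N) → ℝ} {a b s : ℝ}

theorem sq_integral_mul_le {α : Type*} [MeasurableSpace α] {μ : Measure α} {f g : α → ℝ}
    (hf : Integrable (fun x => f x ^ 2) μ) (hg : Integrable (fun x => g x ^ 2) μ)
    (hfg : Integrable (fun x => f x * g x) μ) :
    (∫ x, f x * g x ∂μ) ^ 2 ≤ (∫ x, f x ^ 2 ∂μ) * ∫ x, g x ^ 2 ∂μ := by
  have h (t : ℝ) : 0 ≤ (∫ x, f x ^ 2 ∂μ) * (t * t) + (2 * ∫ x, f x * g x ∂μ) * t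
      + ∫ x, g x ^ 2 ∂μ := by
    have h1 : (∫ x, f x ^ 2 ∂μ) * (t * t) + (2 * ∫ x, f x * g x ∂μ) * t + ∫ x, g x ^ 2 ∂μ
        = ∫ x, (t * f x + g x) ^ 2 ∂μ := by
      have h2 : ∀ x, (t * f x + g x) ^ 2
          = t * t * f x ^ 2 + 2 * t * (f x * g x) + g x ^ 2 := fun x => by ring
      simp_rw [h2]
      have h3 : Integrable (fun x => t * t * f x ^ 2 + 2 * t * (f x * g x)) μ :=
        (hf.const_mul _).add (hfg.const_mul _)
      rw [integral_add h3 hg,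
        integral_add (hf.const_mul _) (hfg.const_mul _), integral_const_mul, integral_const_mul]
      ring
    rw [h1]
    exact integral_nonneg fun x => sq_nonneg _
  have := discrim_le_zero h
  rw [discrim] at this
  linarith

/-- Integration by parts for `u (x · ∇u)` with a power weight. -/
theorem two_mul_integral_mul_xDotGrad [NeZero N] (hu : ContDiffOn ℝ 1 u {0}ᶜ)
    (h1 : Integrable (fun x => u x ^ 2 * ‖x‖ ^ (-s)))
    (h2 : Integrable (fun x => u x * xDotGrad u x * ‖x‖ ^ (-s))) :
    2 * ∫ x, u x * xDotGrad u x * ‖x‖ ^ (-s)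
      = -((N : ℝ) - s) * ∫ x, u x ^ 2 * ‖x‖ ^ (-s) := by
  have hc : ContDiffOn ℝ 1 (fun x => u x ^ 2 * ‖x‖ ^ (-s)) {0}ᶜ :=
    (hu.pow 2).mul (contDiffOn_norm_rpow _ _)
  have hae : xDotGrad (fun x => u x ^ 2 * ‖x‖ ^ (-s)) =ᵐ[volume]
      fun x => 2 * (u x * xDotGrad u x * ‖x‖ ^ (-s)) + -s * (u x ^ 2 * ‖x‖ ^ (-s)) := by
    filter_upwards [ae_ne_zero] with x hx
    rw [xDotGrad_mul ((hu.pow 2).differentiableAt_of_ne_zero hx)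
      ((contDiffOn_norm_rpow (-s) 1).differentiableAt_of_ne_zero hx), xDotGrad_norm_rpow _ hx,
      xDotGrad_sq (hu.differentiableAt_of_ne_zero hx)]
    ring
  have hi := (h2.const_mul 2).add (h1.const_mul (-s))
  have h := integral_xDotGrad hc h1 (hi.congr hae.symm)
  rw [integral_congr_ae hae, integral_add (h2.const_mul 2) (h1.const_mul (-s)),
    integral_const_mul, integral_const_mul] at h
  linarith

/-- Expansion of the square of `x · ∇u - γ u`. -/
theorem integral_xDotGrad_sub_sq [NeZero N] (hu : ContDiffOn ℝ 1 u {0}ᶜ) (γ : ℝ)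
    (h1 : Integrable (fun x => u x ^ 2 * ‖x‖ ^ (-s)))
    (h2 : Integrable (fun x => u x * xDotGrad u x * ‖x‖ ^ (-s)))
    (h3 : Integrable (fun x => xDotGrad u x ^ 2 * ‖x‖ ^ (-s))) :
    ∫ x, (xDotGrad u x - γ * u x) ^ 2 * ‖x‖ ^ (-s)
      = (∫ x, xDotGrad u x ^ 2 * ‖x‖ ^ (-s))
        + γ * (γ + (N - s)) * ∫ x, u x ^ 2 * ‖x‖ ^ (-s) := by
  have h : ∀ x, (xDotGrad u x - γ * u x) ^ 2 * ‖x‖ ^ (-s)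
      = xDotGrad u x ^ 2 * ‖x‖ ^ (-s) + (-(2 * γ) * (u x * xDotGrad u x * ‖x‖ ^ (-s))
        + γ ^ 2 * (u x ^ 2 * ‖x‖ ^ (-s))) := fun x => by ring
  simp_rw [h]
  have h4 : Integrable (fun x => -(2 * γ) * (u x * xDotGrad u x * ‖x‖ ^ (-s))
      + γ ^ 2 * (u x ^ 2 * ‖x‖ ^ (-s))) := (h2.const_mul _).add (h1.const_mul _)
  rw [integral_add h3 h4,
    integral_add (h2.const_mul _) (h1.const_mul _), integral_const_mul, integral_const_mul]
  have := two_mul_integral_mul_xDotGrad hu h1 h2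
  linear_combination -γ * this

theorem CKNTest.integrable_mul_xDotGrad (hu : CKNTest u) (s : ℝ) :
    Integrable (fun x => u x * _root_.xDotGrad u x * ‖x‖ ^ s) := by
  have := integrable_mul_of_zero_notMem_tsupport hu.1.continuous hu.2.1 hu.2.2
    (hu.contDiff_one.continuous_xDotGrad.continuousOn.mul (continuousOn_norm_rpow s))
  simpa [mul_assoc] using this

/-- The condition on γ says that subtracting γu from x·∇u preserves its weighted norm, while it
shifts the mixed term ∫ u (x·∇u)|x|^{-(a+b+1)} by -γ ∫ u²|x|^{-(a+b+1)}. Cauchy-Schwarz then gives a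
second constant besides the one for γ = 0. -/
theorem CKNTest.cknIneq [NeZero N] (hu : CKNTest u) {γ : ℝ}
    (hγ : γ * (γ + (N - (2 * b + 2))) = 0) :
    CKNIneq a b (ENNReal.ofReal (|(N : ℝ) - (a + b + 1) + 2 * γ| / 2)) u := by
  have hu1 : ContDiffOn ℝ 1 u {0}ᶜ := hu.contDiff_one.contDiffOn
  have i1 (s : ℝ) := hu.integrable_sq s
  have i2 (s : ℝ) := hu.integrable_mul_xDotGrad s
  have i3 (s : ℝ) := hu.integrable_xDotGrad_sq s
  rw [CKNIneq, weightedSq_eq_ofReal (i1 _), weightedSq_eq_ofReal (i1 _),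
    weightedSq_eq_ofReal (i3 _), ← ENNReal.ofReal_pow (by positivity),
    ← ENNReal.ofReal_pow (integral_nonneg fun x => by positivity),
    ← ENNReal.ofReal_mul (by positivity),
    ← ENNReal.ofReal_mul (integral_nonneg fun x => by positivity)]
  refine ENNReal.ofReal_le_ofReal ?_
  have hV := integral_xDotGrad_sub_sq hu1 γ (i1 (-(2 * b + 2))) (i2 _) (i3 _)
  rw [hγ, zero_mul, add_zero] at hV
  have hB := two_mul_integral_mul_xDotGrad hu1 (i1 (-(a + b + 1))) (i2 _)
  have e1 : ∀ x : EuclideanSpace ℝ (Fin N), (u x * ‖x‖ ^ (-a)) ^ 2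
      = u x ^ 2 * ‖x‖ ^ (-(2 * a)) := fun x => by
    rw [mul_pow, ← Real.rpow_natCast (‖x‖ ^ (-a)), ← Real.rpow_mul (norm_nonneg x)]
    congr 2; push_cast; ring
  have e2 : ∀ x : EuclideanSpace ℝ (Fin N), ((xDotGrad u x - γ * u x) * ‖x‖ ^ (-(b + 1))) ^ 2
      = (xDotGrad u x - γ * u x) ^ 2 * ‖x‖ ^ (-(2 * b + 2)) := fun x => by
    rw [mul_pow, ← Real.rpow_natCast (‖x‖ ^ (-(b + 1))), ← Real.rpow_mul (norm_nonneg x)]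
    congr 2; push_cast; ring
  have e3 : (fun x : EuclideanSpace ℝ (Fin N) =>
      (u x * ‖x‖ ^ (-a)) * ((xDotGrad u x - γ * u x) * ‖x‖ ^ (-(b + 1)))) =ᵐ[volume]
      fun x => u x * xDotGrad u x * ‖x‖ ^ (-(a + b + 1))
        + -γ * (u x ^ 2 * ‖x‖ ^ (-(a + b + 1))) := by
    filter_upwards [ae_ne_zero] with x hx
    have : ‖x‖ ^ (-(a + b + 1)) = ‖x‖ ^ (-a) * ‖x‖ ^ (-(b + 1)) := by
      rw [← Real.rpow_add (norm_pos_iff.2 hx)]; congr 1; ring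
    rw [this]; ring
  have i4 : Integrable (fun x => (xDotGrad u x - γ * u x) ^ 2 * ‖x‖ ^ (-(2 * b + 2))) := by
    have := ((i3 (-(2 * b + 2))).add ((i2 (-(2 * b + 2))).const_mul (-(2 * γ)))).add
      ((i1 (-(2 * b + 2))).const_mul (γ ^ 2))
    refine this.congr (ae_of_all _ fun x => ?_)
    simp only [Pi.add_apply]
    ring
  have hCS := sq_integral_mul_le (f := fun x : EuclideanSpace ℝ (Fin N) => u x * ‖x‖ ^ (-a))
    (g := fun x => (xDotGrad u x - γ * u x) * ‖x‖ ^ (-(b + 1))) (μ := volume)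
    (by simpa only [e1] using i1 _) (by simpa only [e2] using i4)
    (((i2 _).add ((i1 _).const_mul _)).congr e3.symm)
  simp only [e1, e2] at hCS
  rw [integral_congr_ae e3, integral_add (i2 _) ((i1 _).const_mul _), integral_const_mul, hV] at hCS
  refine le_trans (le_of_eq ?_) hCS
  rw [div_pow, sq_abs]
  have h6 : (∫ x, u x * xDotGrad u x * ‖x‖ ^ (-(a + b + 1)))
      = -((N : ℝ) - (a + b + 1)) / 2 * ∫ x, u x ^ 2 * ‖x‖ ^ (-(a + b + 1)) := by linarith
  rw [h6]
  ring

theorem ofReal_le_cknConst [NeZero N] {γ : ℝ} (hγ : γ * (γ + (N - (2 * b + 2))) = 0) :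
    ENNReal.ofReal (|(N : ℝ) - (a + b + 1) + 2 * γ| / 2) ≤ cknConst N a b :=
  le_cknConst_iff.2 fun _ hu => hu.cknIneq hγ

end LowerBound

/-! ### The extremal profiles: integrability, membership and the value of the quotient. -/

section Minimizer

variable {N : ℕ} {D : EuclideanSpace ℝ (Fin N) → ℝ} {γ k t c q : ℝ}

/-- The substitution y = r^k, valid for either sign of k, turns this into a Gamma integral with
exponent q/k - 1 > -1. -/
theorem integrableOn_rpow_mul_exp_neg (hc : 0 < c) (hkq : 0 < k * q) :
    IntegrableOn (fun r : ℝ => r ^ (q - 1) * Real.exp (-c * r ^ k)) (Ioi 0) := by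
  have hk : k ≠ 0 := by rintro rfl; simp at hkq
  have hqk : 0 < q / k := by
    rcases lt_or_gt_of_ne hk with h | h
    · exact div_pos_of_neg_of_neg (by nlinarith) h
    · exact div_pos (by nlinarith) h
  have h1 := integrableOn_rpow_mul_exp_neg_mul_rpow (p := 1) (s := q / k - 1) (b := c)
    (by linarith) one_pos hc
  rw [← integrableOn_Ioi_comp_rpow_iff' _ hk] at h1
  refine h1.congr_fun (fun r hr => ?_) measurableSet_Ioi
  have hr : 0 < r := hr
  simp only [smul_eq_mul, Real.rpow_one]
  rw [← mul_assoc, ← Real.rpow_mul hr.le, ← Real.rpow_add hr]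
  congr 2
  field_simp
  ring

/-- With y = r^k and σ = q/k this is y^σ exp(-cy) ≤ (σ/c)^σ, the σ-th power of z ≤ exp z at z =
cy/σ. -/
theorem rpow_mul_exp_neg_le (hc : 0 < c) (hk : k ≠ 0) (hkq : 0 ≤ k * q) {r : ℝ} (hr : 0 < r) :
    r ^ q * Real.exp (-c * r ^ k) ≤ ((q / k) / c) ^ (q / k) := by
  have hqk : 0 ≤ q / k := by
    rcases lt_or_gt_of_ne hk with h | h
    · exact div_nonneg_of_nonpos (by nlinarith) h.le
    · exact div_nonneg (by nlinarith) h.le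
  have hy : 0 < r ^ k := Real.rpow_pos_of_pos hr k
  have h1 : r ^ q = (r ^ k) ^ (q / k) := by
    rw [← Real.rpow_mul hr.le]; congr 1; field_simp
  rw [h1, neg_mul, Real.exp_neg, ← div_eq_mul_inv, div_le_iff₀ (Real.exp_pos _)]
  -- For q = 0 the right-hand side is `0 ^ 0 = 1`, so only exp(-c r^k) ≤ 1 remains.
  rcases hqk.eq_or_lt with h0 | hpos
  · rw [← h0]
    simpa using (mul_pos hc hy).le
  · have hq : q ≠ 0 := by
      rintro rfl
      simp at hpos
    have h2 : r ^ k ≤ (q / k) / c * Real.exp (c * r ^ k / (q / k)) := by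
      have := Real.add_one_le_exp (c * r ^ k / (q / k))
      calc r ^ k = (q / k) / c * (c * r ^ k / (q / k)) := by field_simp
        _ ≤ _ := by gcongr; linarith
    calc (r ^ k) ^ (q / k) ≤ ((q / k) / c * Real.exp (c * r ^ k / (q / k))) ^ (q / k) :=
          Real.rpow_le_rpow hy.le h2 hqk
      _ = _ := by
        rw [Real.mul_rpow (by positivity) (Real.exp_pos _).le, ← Real.exp_mul,
          div_mul_cancel₀ _ hpos.ne']

theorem AngularProfile.exists_bound (hD : AngularProfile D) :
    ∃ M : ℝ, ∀ x, x ≠ 0 → |D (‖x‖⁻¹ • x)| ≤ M := by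
  have hK : IsCompact (Metric.sphere (0 : EuclideanSpace ℝ (Fin N)) 1) := isCompact_sphere 0 1
  have hc : ContinuousOn (fun x : EuclideanSpace ℝ (Fin N) => D (‖x‖⁻¹ • x))
      (Metric.sphere 0 1) := hD.1.continuousOn.mono fun x hx => by
    rintro rfl
    simp at hx
  obtain ⟨M, hM⟩ := hK.exists_bound_of_continuousOn hc
  refine ⟨M, fun x hx => ?_⟩
  have hn : ‖‖x‖⁻¹ • x‖ = 1 := norm_smul_inv_norm (𝕜 := ℝ) hx
  have := hM (‖x‖⁻¹ • x) (by simpa using hn)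
  rw [hn, inv_one, one_smul] at this
  exact this

/-- The profile `D(x/|x|) |x|^γ exp(t |x|^k / k)`. -/
noncomputable def powerExpProfile (γ k t : ℝ) (D : EuclideanSpace ℝ (Fin N) → ℝ) :
    EuclideanSpace ℝ (Fin N) → ℝ :=
  fun x => D (‖x‖⁻¹ • x) * ‖x‖ ^ γ * Real.exp (t * ‖x‖ ^ k / k)

theorem contDiffOn_exp_norm_rpow (k t : ℝ) (n : ℕ∞ω) :
    ContDiffOn ℝ n (fun x : EuclideanSpace ℝ (Fin N) => Real.exp (t * ‖x‖ ^ k / k)) {0}ᶜ :=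
  ((contDiffOn_const.mul (contDiffOn_norm_rpow k n)).div_const k).exp

theorem AngularProfile.contDiffOn_powerExpProfile (hD : AngularProfile D) (γ k t : ℝ) :
    ContDiffOn ℝ 1 (powerExpProfile γ k t D) {0}ᶜ :=
  (hD.1.mul (contDiffOn_norm_rpow γ 1)).mul (contDiffOn_exp_norm_rpow k t 1)

theorem AngularProfile.xDotGrad_powerExpProfile (hD : AngularProfile D) (hk : k ≠ 0)
    {x : EuclideanSpace ℝ (Fin N)} (hx : x ≠ 0) :
    xDotGrad (powerExpProfile γ k t D) x = (γ + t * ‖x‖ ^ k) * powerExpProfile γ k t D x := by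
  have hxp := norm_pos_iff.2 hx
  have d1 : DifferentiableAt ℝ (fun x : EuclideanSpace ℝ (Fin N) => D (‖x‖⁻¹ • x)) x :=
    hD.1.differentiableAt_of_ne_zero hx
  have d2 := (contDiffOn_norm_rpow (N := N) γ 1).differentiableAt_of_ne_zero hx
  have d3 := (contDiffOn_exp_norm_rpow (N := N) k t 1).differentiableAt_of_ne_zero hx
  have g1 : xDotGrad (fun x : EuclideanSpace ℝ (Fin N) => D (‖x‖⁻¹ • x)) x = 0 := by
    refine xDotGrad_eq_of_hasDerivAt_ray d1 ?_
    refine (hasDerivAt_const (1 : ℝ) (D (‖x‖⁻¹ • x))).congr_of_eventuallyEq ?_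
    filter_upwards [lt_mem_nhds (zero_lt_one (α := ℝ))] with l hl
    rw [norm_smul, Real.norm_of_nonneg hl.le, smul_smul]
    congr 2
    field_simp
  have g3 : xDotGrad (fun x : EuclideanSpace ℝ (Fin N) => Real.exp (t * ‖x‖ ^ k / k)) x
      = t * ‖x‖ ^ k * Real.exp (t * ‖x‖ ^ k / k) := by
    have h := (((Real.hasDerivAt_rpow_const (p := k) (Or.inl hxp.ne')).const_mul t).div_const
      k).exp
    rw [xDotGrad_radial (p := fun r => Real.exp (t * r ^ k / k)) hx h,
      Real.rpow_sub_one hxp.ne']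
    field_simp
  have h := xDotGrad_mul (d1.mul d2) d3
  have h' := xDotGrad_mul d1 d2
  rw [g1, xDotGrad_norm_rpow γ hx] at h'
  simp only [Pi.mul_def] at h
  rw [g3, h'] at h
  have h'' : xDotGrad (powerExpProfile γ k t D) x = _ := h
  rw [h'', powerExpProfile]
  ring

theorem powerExpProfile_sq_mul_le {M e : ℝ} {x : EuclideanSpace ℝ (Fin N)} (hx : x ≠ 0)
    (hM : |D (‖x‖⁻¹ • x)| ≤ M) :
    powerExpProfile γ k t D x ^ 2 * ‖x‖ ^ e
      ≤ M ^ 2 * (‖x‖ ^ (2 * γ + e) * Real.exp (-(-2 * t / k) * ‖x‖ ^ k)) := by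
  have hxp := norm_pos_iff.2 hx
  have h1 : powerExpProfile γ k t D x ^ 2 * ‖x‖ ^ e = D (‖x‖⁻¹ • x) ^ 2 *
      (‖x‖ ^ (2 * γ + e) * Real.exp (-(-2 * t / k) * ‖x‖ ^ k)) := by
    have h2 : ‖x‖ ^ (2 * γ + e) = (‖x‖ ^ γ) ^ 2 * ‖x‖ ^ e := by
      rw [Real.rpow_add hxp, mul_comm 2 γ, Real.rpow_mul hxp.le, Real.rpow_two]
    have h3 : Real.exp (-(-2 * t / k) * ‖x‖ ^ k) = Real.exp (t * ‖x‖ ^ k / k) ^ 2 := by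
      rw [← Real.exp_nat_mul]
      congr 1
      push_cast
      ring
    rw [h2, h3, powerExpProfile]
    ring
  rw [h1]
  exact mul_le_mul_of_nonneg_right (sq_le_sq.2 (hM.trans (le_abs_self M))) (by positivity)

/-- As tk < 0, the exponential decays at infinity if k > 0 and at the origin if k < 0; the condition
on e is convergence of the power at the other end. -/
theorem AngularProfile.integrable_powerExpProfile_sq [NeZero N] (hD : AngularProfile D)
    (htk : t * k < 0) {e : ℝ} (he : 0 < k * (2 * γ + e + N)) :
    Integrable (fun x => powerExpProfile γ k t D x ^ 2 * ‖x‖ ^ e) := by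
  obtain ⟨M, hM⟩ := hD.exists_bound
  have hk : k ≠ 0 := by rintro rfl; simp at htk
  have hc : 0 < -2 * t / k := by
    rw [show -2 * t / k = 2 * (-(t * k)) / k ^ 2 by field_simp]
    have : 0 < -(t * k) := by linarith
    positivity
  have hr : Integrable (fun x : EuclideanSpace ℝ (Fin N) =>
      M ^ 2 * (‖x‖ ^ (2 * γ + e) * Real.exp (-(-2 * t / k) * ‖x‖ ^ k))) := by
    refine Integrable.const_mul ?_ _
    rw [integrable_fun_norm_addHaar volume
      (f := fun r => r ^ (2 * γ + e) * Real.exp (-(-2 * t / k) * r ^ k))]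
    refine (integrableOn_rpow_mul_exp_neg hc he).congr_fun (fun r hr => ?_) measurableSet_Ioi
    have hr : 0 < r := hr
    simp only [smul_eq_mul, finrank_euclideanSpace_fin]
    rw [← Real.rpow_natCast, Nat.cast_pred (Nat.pos_of_neZero N), ← mul_assoc, ← Real.rpow_add hr]
    congr 2
    ring
  have hm := ContinuousOn.aestronglyMeasurable_of_compl_zero
    (hD.contDiffOn_powerExpProfile γ k t).continuousOn
  refine hr.mono' (aestronglyMeasurable_mul_norm_rpow (hm.pow 2) e) ?_
  filter_upwards [ae_ne_zero] with x hx
  rw [Real.norm_of_nonneg (by positivity)]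
  exact powerExpProfile_sq_mul_le hx (hM x hx)

theorem AngularProfile.not_ae_eq_zero (hD : AngularProfile D) :
    ¬ powerExpProfile γ k t D =ᵐ[volume] 0 := by
  intro h
  obtain ⟨σ, hσ, hDσ⟩ := hD.2
  have hc := (hD.contDiffOn_powerExpProfile γ k t).continuousOn
  have ho := hc.isOpen_inter_preimage isOpen_compl_singleton
    (isOpen_compl_singleton (x := (0 : ℝ)))
  have hσ0 : σ ≠ 0 := by
    rintro rfl
    simp at hσ
  refine ho.measure_ne_zero volume ⟨σ, hσ0, ?_⟩ (measure_mono_null ?_ (ae_iff.1 h))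
  · simp [powerExpProfile, hσ, hDσ]
  · intro x hx
    exact hx.2

theorem angularProfile_one [NeZero N] :
    AngularProfile (fun _ : EuclideanSpace ℝ (Fin N) => (1 : ℝ)) := by
  obtain ⟨σ, hσ⟩ := exists_norm_eq (EuclideanSpace ℝ (Fin N)) zero_le_one
  exact ⟨contDiffOn_const, σ, hσ, one_ne_zero⟩

/-- The profile solves x·∇U - γU = t|x|^k U, the equality case of Cauchy-Schwarz, so all integrals
reduce to those of U²|x|^{-2a} and U²|x|^{-(a+b+1)}. `hp` gives the boundedness needed for
membership. If γ ≠ 0, the strict inequality in `hγ` also makes U²|x|^{-(2b+2)} integrable, so that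
the square can be expanded. -/
theorem AngularProfile.powerExpProfile_spec [NeZero N] (hD : AngularProfile D) {a b : ℝ}
    (hk : k = b + 1 - a) (htk : t * k < 0) (hp : 0 ≤ k * (2 * γ + (N - (2 * b + 2))))
    (hγ : γ = 0 ∨ γ + (N - (2 * b + 2)) = 0 ∧ 0 < k * (2 * γ + (N - (2 * b + 2)))) :
    MemCKNSpace a b (powerExpProfile γ k t D) (xDotGrad (powerExpProfile γ k t D)) ∧
    cknQuotient a b (powerExpProfile γ k t D) (xDotGrad (powerExpProfile γ k t D))
      = ENNReal.ofReal (|(N : ℝ) - (a + b + 1) + 2 * γ| / 2) := by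
  obtain ⟨M, hM⟩ := hD.exists_bound
  have hk0 : k ≠ 0 := by rintro rfl; simp at htk
  have hk2 : 0 < k ^ 2 := by positivity
  have hc : 0 < -2 * t / k := by
    rw [show -2 * t / k = 2 * (-(t * k)) / k ^ 2 by field_simp]
    have : 0 < -(t * k) := by linarith
    positivity
  set U := powerExpProfile γ k t D with hU
  have hCU : ContDiffOn ℝ 1 U {0}ᶜ := hD.contDiffOn_powerExpProfile γ k t
  have hG : ∀ x, x ≠ 0 → xDotGrad U x = (γ + t * ‖x‖ ^ k) * U x :=
    fun x hx => hD.xDotGrad_powerExpProfile hk0 hx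
  -- The exponents -2a and -(a+b+1) exceed -(2b+2) by 2k and k; this adds 2k² and k² to the quantity
  -- in `hp`, so strict positivity is automatic.
  have ia : Integrable (fun x => U x ^ 2 * ‖x‖ ^ (-(2 * a))) :=
    hD.integrable_powerExpProfile_sq htk (by
      have : k * (2 * γ + -(2 * a) + N) = k * (2 * γ + (N - (2 * b + 2))) + 2 * k ^ 2 := by
        rw [hk]; ring
      linarith)
  have is : Integrable (fun x => U x ^ 2 * ‖x‖ ^ (-(a + b + 1))) :=
    hD.integrable_powerExpProfile_sq htk (by
      have : k * (2 * γ + -(a + b + 1) + N) = k * (2 * γ + (N - (2 * b + 2))) + k ^ 2 := by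
        rw [hk]; ring
      linarith)
  have hpow (x : EuclideanSpace ℝ (Fin N)) (hx : x ≠ 0) (e e' : ℝ) (h : k + e = e') :
      ‖x‖ ^ k * ‖x‖ ^ e = ‖x‖ ^ e' := by
    rw [← Real.rpow_add (norm_pos_iff.2 hx), h]
  have hsub : (fun x => (xDotGrad U x - γ * U x) ^ 2 * ‖x‖ ^ (-(2 * b + 2))) =ᵐ[volume]
      fun x => t ^ 2 * (U x ^ 2 * ‖x‖ ^ (-(2 * a))) := by
    filter_upwards [ae_ne_zero] with x hx
    rw [hG x hx, ← hpow x hx (-(a + b + 1)) (-(2 * a)) (by rw [hk]; ring),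
      ← hpow x hx (-(2 * b + 2)) (-(a + b + 1)) (by rw [hk]; ring)]
    ring
  have hmix : (fun x => U x * xDotGrad U x * ‖x‖ ^ (-(a + b + 1))) =ᵐ[volume]
      fun x => γ * (U x ^ 2 * ‖x‖ ^ (-(a + b + 1))) + t * (U x ^ 2 * ‖x‖ ^ (-(2 * a))) := by
    filter_upwards [ae_ne_zero] with x hx
    rw [hG x hx, ← hpow x hx (-(a + b + 1)) (-(2 * a)) (by rw [hk]; ring)]
    ring
  have hmix' : (fun x => U x * xDotGrad U x * ‖x‖ ^ (-(2 * b + 2))) =ᵐ[volume]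
      fun x => γ * (U x ^ 2 * ‖x‖ ^ (-(2 * b + 2))) + t * (U x ^ 2 * ‖x‖ ^ (-(a + b + 1))) := by
    filter_upwards [ae_ne_zero] with x hx
    rw [hG x hx, ← hpow x hx (-(2 * b + 2)) (-(a + b + 1)) (by rw [hk]; ring)]
    ring
  have iV : Integrable (fun x => xDotGrad U x ^ 2 * ‖x‖ ^ (-(2 * b + 2))) ∧
      ∫ x, xDotGrad U x ^ 2 * ‖x‖ ^ (-(2 * b + 2))
        = t ^ 2 * ∫ x, U x ^ 2 * ‖x‖ ^ (-(2 * a)) := by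
    have i1 := (ia.const_mul (t ^ 2)).congr hsub.symm
    have h1 := integral_congr_ae hsub
    rw [integral_const_mul] at h1
    -- For γ = 0 the identity `hsub` already is the claim, and U²|x|^{-(2b+2)} is not needed; it may
    -- fail to be integrable when `hp` is an equality.
    rcases hγ with h0 | ⟨h0, hpos⟩
    · simp only [h0, zero_mul, sub_zero] at i1 h1
      exact ⟨i1, h1⟩
    · have ib : Integrable (fun x => U x ^ 2 * ‖x‖ ^ (-(2 * b + 2))) :=
        hD.integrable_powerExpProfile_sq htk (by
          have : k * (2 * γ + -(2 * b + 2) + N) = k * (2 * γ + (N - (2 * b + 2))) := by ring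
          linarith)
      have im := ((ib.const_mul γ).add (is.const_mul t)).congr hmix'.symm
      have iv : Integrable (fun x => xDotGrad U x ^ 2 * ‖x‖ ^ (-(2 * b + 2))) := by
        refine ((i1.add (im.const_mul (2 * γ))).sub (ib.const_mul (γ ^ 2))).congr
          (ae_of_all _ fun x => ?_)
        simp only [Pi.add_apply, Pi.sub_apply]
        ring
      refine ⟨iv, ?_⟩
      have h2 := integral_xDotGrad_sub_sq hCU γ ib im iv
      rw [h0, mul_zero, zero_mul, add_zero] at h2
      rw [← h2, h1]
  refine ⟨memCKNSpace_of_contDiffOn hCU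
    (B := M ^ 2 * (((2 * γ + (N - (2 * b + 2))) / k) / (-2 * t / k))
      ^ ((2 * γ + (N - (2 * b + 2))) / k)) (fun x hx => ?_)
    (weightedSq_ne_top_of_integrable ia) (weightedSq_ne_top_of_integrable iV.1), ?_⟩
  · refine (powerExpProfile_sq_mul_le hx (hM x hx)).trans ?_
    gcongr
    exact rpow_mul_exp_neg_le hc hk0 hp (norm_pos_iff.2 hx)
  have him := ((is.const_mul γ).add (ia.const_mul t)).congr hmix.symm
  have hid := two_mul_integral_mul_xDotGrad hCU is him
  rw [integral_congr_ae hmix, integral_add (is.const_mul γ) (ia.const_mul t),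
    integral_const_mul, integral_const_mul] at hid
  have hA0 : 0 ≤ ∫ x, U x ^ 2 * ‖x‖ ^ (-(2 * a)) := integral_nonneg fun x => by positivity
  have hW0 : 0 ≤ ∫ x, U x ^ 2 * ‖x‖ ^ (-(a + b + 1)) := integral_nonneg fun x => by positivity
  have hreal : |t| * ∫ x, U x ^ 2 * ‖x‖ ^ (-(2 * a))
      = |(N : ℝ) - (a + b + 1) + 2 * γ| / 2 * ∫ x, U x ^ 2 * ‖x‖ ^ (-(a + b + 1)) := by
    have h1 : t * ∫ x, U x ^ 2 * ‖x‖ ^ (-(2 * a))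
        = -(((N : ℝ) - (a + b + 1) + 2 * γ) / 2 * ∫ x, U x ^ 2 * ‖x‖ ^ (-(a + b + 1))) := by
      linarith
    have h2 := congrArg abs h1
    rwa [abs_neg, abs_mul, abs_mul, abs_of_nonneg hA0, abs_of_nonneg hW0, abs_div,
      abs_two] at h2
  have hWne : weightedSq (a + b + 1) U ≠ 0 := by
    rw [Ne, weightedSq_eq_zero_iff (ContinuousOn.aestronglyMeasurable_of_compl_zero hCU.continuousOn)]
    exact hD.not_ae_eq_zero
  symm
  rw [cknQuotient, ENNReal.eq_div_iff hWne (weightedSq_ne_top_of_integrable is),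
    weightedSq_eq_ofReal ia, weightedSq_eq_ofReal is, weightedSq_eq_ofReal iV.1, iV.2,
    ENNReal.ofReal_rpow_of_nonneg hA0 (by norm_num),
    ENNReal.ofReal_rpow_of_nonneg (by positivity) (by norm_num),
    ← ENNReal.ofReal_mul hW0, ← ENNReal.ofReal_mul (Real.rpow_nonneg hA0 _),
    mul_comm _ (|(N : ℝ) - (a + b + 1) + 2 * γ| / 2), ← hreal,
    ← Real.sqrt_eq_rpow, ← Real.sqrt_eq_rpow, Real.sqrt_mul (sq_nonneg t), Real.sqrt_sq_eq_abs,
    mul_left_comm, Real.mul_self_sqrt hA0]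

theorem cknConst_eq_of_profile [NeZero N] {a b : ℝ} (hk : k = b + 1 - a) (hk0 : k ≠ 0)
    (hp : 0 ≤ k * (2 * γ + (N - (2 * b + 2))))
    (hγ : γ = 0 ∨ γ + (N - (2 * b + 2)) = 0 ∧ 0 < k * (2 * γ + (N - (2 * b + 2)))) :
    cknConst N a b = ENNReal.ofReal (|(N : ℝ) - (a + b + 1) + 2 * γ| / 2) := by
  -- The witness is t = -k with constant angular profile.
  have htk : -k * k < 0 := by
    have : 0 < k ^ 2 := by positivity
    linarith
  obtain ⟨h1, h2⟩ := angularProfile_one.powerExpProfile_spec (N := N) hk htk hp hγ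
  refine le_antisymm (h2 ▸ cknConst_le_cknQuotient h1 angularProfile_one.not_ae_eq_zero)
    (ofReal_le_cknConst ?_)
  rcases hγ with h | ⟨h, -⟩ <;> simp [h]

end Minimizer

/-! ### The line a = b + 1: sharp Hardy constant and non-attainment. -/

section Hardy

variable {N : ℕ} {u f : EuclideanSpace ℝ (Fin N) → ℝ} {b s : ℝ}

theorem CKNTest.cknIneq_iff_hardyIneq (hu : CKNTest u) (b : ℝ) (C : ℝ≥0∞) :
    CKNIneq (b + 1) b C u ↔ HardyIneq b C u := by
  rw [CKNIneq, HardyIneq, show b + 1 + b + 1 = 2 * b + 2 by ring,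
    show 2 * (b + 1) = 2 * b + 2 by ring]
  by_cases h0 : weightedSq (2 * b + 2) u = 0
  · simp [h0]
  · rw [sq (weightedSq _ _), mul_left_comm,
      ENNReal.mul_le_mul_iff_right h0 (hu.weightedSq_ne_top _)]

theorem weightedSq_mul_norm_rpow [NeZero N] (s τ : ℝ) (f : EuclideanSpace ℝ (Fin N) → ℝ) :
    weightedSq s (fun x => f x * ‖x‖ ^ τ) = weightedSq (s - 2 * τ) f := by
  refine lintegral_congr_ae ?_
  filter_upwards [ae_ne_zero] with x hx
  rw [sq_div_norm_rpow, sq_div_norm_rpow, show -(s - 2 * τ) = τ + τ + -s by ring,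
    Real.rpow_add (norm_pos_iff.2 hx), Real.rpow_add (norm_pos_iff.2 hx)]
  congr 1
  ring

/-- Completing the square in the weighted Hardy inequality. -/
theorem CKNTest.weightedSq_xDotGrad_eq [NeZero N] (hu : CKNTest u) (s : ℝ) :
    weightedSq s (_root_.xDotGrad u)
      = ENNReal.ofReal (|(N : ℝ) - s| / 2) ^ 2 * weightedSq s u
        + weightedSq s (fun x => _root_.xDotGrad u x - -((N - s) / 2) * u x) := by
  have i1 := hu.integrable_sq (-s)
  have i2 := hu.integrable_mul_xDotGrad (-s)
  have i3 := hu.integrable_xDotGrad_sq (-s)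
  have i4 : Integrable (fun x =>
      (_root_.xDotGrad u x - -((N - s) / 2) * u x) ^ 2 * ‖x‖ ^ (-s)) := by
    refine ((i3.add (i2.const_mul (N - s))).add (i1.const_mul (((N - s) / 2) ^ 2))).congr
      (ae_of_all _ fun x => ?_)
    simp only [Pi.add_apply]
    ring
  have h := integral_xDotGrad_sub_sq hu.contDiff_one.contDiffOn (-((N - s) / 2)) i1 i2 i3
  rw [weightedSq_eq_ofReal i1, weightedSq_eq_ofReal i3, weightedSq_eq_ofReal i4, h,
    ← ENNReal.ofReal_pow (by positivity), ← ENNReal.ofReal_mul (by positivity),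
    ← ENNReal.ofReal_add (mul_nonneg (by positivity) (integral_nonneg fun x => by positivity))
      (h ▸ integral_nonneg fun x => by positivity), div_pow, sq_abs]
  congr 1
  ring

theorem xDotGrad_sub_mul_of_mul_norm_rpow (hf : ContDiff ℝ 1 f)
    {x : EuclideanSpace ℝ (Fin N)} (hx : x ≠ 0) (τ : ℝ) :
    xDotGrad (fun y => f y * ‖y‖ ^ τ) x - τ * (f x * ‖x‖ ^ τ) = xDotGrad f x * ‖x‖ ^ τ := by
  rw [xDotGrad_mul_of_contDiffOn hf (contDiffOn_norm_rpow _ _), xDotGrad_norm_rpow _ hx]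
  ring

theorem weightedSq_mono (h : ∀ x, |u x| ≤ |f x|) : weightedSq s u ≤ weightedSq s f :=
  lintegral_mono fun x => ENNReal.ofReal_le_ofReal
    (div_le_div_of_nonneg_right (pow_le_pow_left₀ (abs_nonneg _) (h x) 2) (by positivity))

/-- On logCutoff · |x|^τ the Hardy remainder becomes the integral of |x·∇ logCutoff|²|x|^{-N}, which
tends to 0, while the integral of logCutoff²|x|^{-N} stays bounded below. The excess over c² in the
Hardy quotient therefore disappears. -/
theorem cknConst_hardy [NeZero N] (b : ℝ) :
    cknConst N (b + 1) b = ENNReal.ofReal (|(N : ℝ) - 2 * (b + 1)| / 2) := by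
  refine le_antisymm ?_ ?_
  swap
  · have := ofReal_le_cknConst (N := N) (a := b + 1) (b := b) (γ := 0) (by simp)
    rwa [show (N : ℝ) - (b + 1 + b + 1) + 2 * 0 = N - 2 * (b + 1) by ring] at this
  rw [← ENNReal.pow_le_pow_left_iff two_ne_zero, show 2 * (b + 1) = 2 * b + 2 by ring]
  set s := 2 * b + 2 with hs
  set c := ENNReal.ofReal (|(N : ℝ) - s| / 2)
  set τ := -(((N : ℝ) - s) / 2) with hτ
  have hsτ : s - 2 * τ = N := by rw [hτ]; ring
  have hE : Tendsto (fun n => weightedSq (N : ℝ) (xDotGrad (logCutoff N n))) atTop (𝓝 0) := by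
    have := tendsto_weightedSq_mul_xDotGrad_logCutoff (N := N) (u := fun _ => 1) (s := N) (B := 1)
      (fun x _ => by simp)
    simpa using this
  have hw0 : weightedSq (N : ℝ) (logCutoff N 0) ≠ 0 := by
    refine (ckntest_logCutoff 0).weightedSq_ne_zero (fun h => ?_) _
    obtain ⟨x, hx⟩ := exists_norm_eq (EuclideanSpace ℝ (Fin N)) zero_le_one
    have hx0 : x ≠ 0 := by
      rintro rfl
      simp at hx
    have := logCutoff_eq_one 0 ((mem_logAnnulus hx0 (R := ((0 : ℕ) : ℝ) + 1)).2 (by simp [hx]))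
    simp [h] at this
  set w := weightedSq (N : ℝ) (logCutoff N 0) with hw
  have hwt : w ≠ ⊤ := (ckntest_logCutoff 0).weightedSq_ne_top _
  -- From n = 1 on, the n-th cutoff is 1 on |log|x|| ≤ n + 1, which contains the support |log|x|| ≤
  -- 2 of the 0-th one; so `w` bounds the denominator below.
  have hkey : ∀ n : ℕ, 1 ≤ n →
      cknConst N (b + 1) b ^ 2 ≤ c ^ 2 + weightedSq (N : ℝ) (xDotGrad (logCutoff N n)) / w := by
    intro n hn
    have hu : CKNTest (fun x : EuclideanSpace ℝ (Fin N) => logCutoff N n x * ‖x‖ ^ τ) :=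
      (ckntest_logCutoff n).mul_right (contDiffOn_norm_rpow _ _)
    have hH := (hu.cknIneq_iff_hardyIneq b _).1 (le_cknConst_iff.1 le_rfl _ hu)
    rw [HardyIneq, ← hs, hu.weightedSq_xDotGrad_eq s, weightedSq_mul_norm_rpow, hsτ] at hH
    have hR : weightedSq s (fun x => xDotGrad (fun y => logCutoff N n y * ‖y‖ ^ τ) x
        - τ * (logCutoff N n x * ‖x‖ ^ τ)) = weightedSq (N : ℝ) (xDotGrad (logCutoff N n)) := by
      rw [← hsτ, ← weightedSq_mul_norm_rpow]
      refine weightedSq_congr_ae ?_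
      filter_upwards [ae_ne_zero] with x hx
      exact xDotGrad_sub_mul_of_mul_norm_rpow (ckntest_logCutoff n).contDiff_one hx τ
    rw [hR] at hH
    have hmono : w ≤ weightedSq (N : ℝ) (logCutoff N n) := by
      refine weightedSq_mono fun x => ?_
      rw [abs_of_nonneg (logCutoff_nonneg _ _), abs_of_nonneg (logCutoff_nonneg _ _)]
      by_cases hx : x ∈ logAnnulus N (n + 1)
      · rw [logCutoff_eq_one n hx]
        exact logCutoff_le_one 0 x
      · have : logCutoff N 0 x = 0 := by
          by_contra h
          have hx2 := support_logCutoff_subset 0 h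
          refine hx ⟨le_trans ?_ hx2.1, hx2.2.trans ?_⟩ <;>
          · apply Real.exp_le_exp.2
            have : (1 : ℝ) ≤ n := by exact_mod_cast hn
            push_cast
            linarith
        rw [this]
        exact logCutoff_nonneg _ _
    rw [← ENNReal.mul_le_mul_iff_left (c := weightedSq (N : ℝ) (logCutoff N n))
      (fun h => hw0 (le_antisymm (h ▸ hmono) zero_le)) ((ckntest_logCutoff n).weightedSq_ne_top _)]
    refine hH.trans ?_
    rw [add_mul]
    gcongr
    calc weightedSq (N : ℝ) (xDotGrad (logCutoff N n))
        = weightedSq (N : ℝ) (xDotGrad (logCutoff N n)) / w * w :=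
          (ENNReal.div_mul_cancel hw0 hwt).symm
      _ ≤ _ := by gcongr
  have hlim : Tendsto (fun n => c ^ 2 + weightedSq (N : ℝ) (xDotGrad (logCutoff N n)) / w) atTop
      (𝓝 (c ^ 2)) := by
    have := (ENNReal.Tendsto.div_const hE (Or.inr hw0)).const_add (c ^ 2)
    simpa using this
  exact ge_of_tendsto hlim (by filter_upwards [eventually_ge_atTop 1] with n hn using hkey n hn)

/-- A radial weight, of which the square is half the radial derivative of `r² / (1 + r²)`. -/
noncomputable def hardyWeight (x : EuclideanSpace ℝ (Fin N)) : ℝ := ‖x‖ / (1 + ‖x‖ ^ 2)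

theorem hardyWeight_nonneg (x : EuclideanSpace ℝ (Fin N)) : 0 ≤ hardyWeight x := by
  unfold hardyWeight; positivity

theorem hardyWeight_le_one (x : EuclideanSpace ℝ (Fin N)) : hardyWeight x ≤ 1 := by
  rw [hardyWeight, div_le_one (by positivity)]
  nlinarith [sq_nonneg (‖x‖ - 1), norm_nonneg x]

theorem continuous_hardyWeight :
    Continuous (hardyWeight : EuclideanSpace ℝ (Fin N) → ℝ) :=
  continuous_norm.div (by fun_prop) fun x => by positivity

/-- Euler's identity for u²|x|^{-s}F with F = |x|²/(1+|x|²), for which x·∇F = 2 `hardyWeight`²,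
expresses the left integral as minus that of u (x·∇u + ((N-s)/2)u)|x|^{-s}F. Cauchy-Schwarz and 0 ≤
F ≤ 1 conclude. The Hardy remainder thus controls u itself, in a weaker norm. -/
theorem CKNTest.weightedSq_mul_hardyWeight_sq_le [NeZero N] (hu : CKNTest u) (s : ℝ) :
    weightedSq s (fun x => u x * hardyWeight x) ^ 2 ≤ weightedSq s u
      * weightedSq s (fun x => _root_.xDotGrad u x - -((N - s) / 2) * u x) := by
  have i1 := hu.integrable_sq (-s)
  have i2 := hu.integrable_mul_xDotGrad (-s)
  have i3 := hu.integrable_xDotGrad_sq (-s)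
  have i4 : Integrable (fun x =>
      (_root_.xDotGrad u x - -((N - s) / 2) * u x) ^ 2 * ‖x‖ ^ (-s)) := by
    refine ((i3.add (i2.const_mul (N - s))).add (i1.const_mul (((N - s) / 2) ^ 2))).congr
      (ae_of_all _ fun x => ?_)
    simp only [Pi.add_apply]
    ring
  let F : EuclideanSpace ℝ (Fin N) → ℝ := fun x => ‖x‖ ^ 2 / (1 + ‖x‖ ^ 2)
  have hF0 (x) : 0 ≤ F x := by positivity
  have hF1 (x) : F x ≤ 1 := by
    refine (div_le_one (by positivity)).2 ?_
    linarith
  have hFc : ContDiff ℝ 1 F :=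
    (contDiff_norm_sq ℝ).div (contDiff_const.add (contDiff_norm_sq ℝ)) fun x => by positivity
  have hF' (x) (hx : x ≠ 0) : _root_.xDotGrad F x = 2 * hardyWeight x ^ 2 := by
    have h1 : HasDerivAt (fun r : ℝ => r ^ 2 / (1 + r ^ 2))
        ((2 * ‖x‖ * (1 + ‖x‖ ^ 2) - ‖x‖ ^ 2 * (2 * ‖x‖)) / (1 + ‖x‖ ^ 2) ^ 2) ‖x‖ := by
      have h2 : HasDerivAt (fun r : ℝ => r ^ 2) (2 * ‖x‖) ‖x‖ := by
        simpa using hasDerivAt_pow 2 ‖x‖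
      exact h2.div (h2.const_add 1) (by positivity)
    rw [xDotGrad_radial (p := fun r : ℝ => r ^ 2 / (1 + r ^ 2)) hx h1, hardyWeight]
    field_simp
    ring
  have mulInt {φ ψ : EuclideanSpace ℝ (Fin N) → ℝ} (hφ : Integrable φ) (hψ : Continuous ψ)
      (hψ1 : ∀ x, |ψ x| ≤ 1) : Integrable (fun x => φ x * ψ x) :=
    hφ.mul_bdd (c := 1) hψ.aestronglyMeasurable (ae_of_all _ hψ1)
  have hFabs (x) : |F x| ≤ 1 := by rw [abs_of_nonneg (hF0 x)]; exact hF1 x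
  have hwabs (x : EuclideanSpace ℝ (Fin N)) : |hardyWeight x ^ 2| ≤ 1 := by
    rw [abs_of_nonneg (by positivity)]
    exact pow_le_one₀ (hardyWeight_nonneg x) (hardyWeight_le_one x)
  have j1 := mulInt i1 hFc.continuous hFabs
  have j2 := mulInt i2 hFc.continuous hFabs
  have j3 := mulInt (ψ := fun x => hardyWeight x ^ 2) i1 (continuous_hardyWeight.pow 2) hwabs
  have hae : _root_.xDotGrad (fun x => u x ^ 2 * ‖x‖ ^ (-s) * F x) =ᵐ[volume] fun x =>
      2 * (u x * _root_.xDotGrad u x * ‖x‖ ^ (-s) * F x) + -s * (u x ^ 2 * ‖x‖ ^ (-s) * F x)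
        + 2 * (u x ^ 2 * ‖x‖ ^ (-s) * hardyWeight x ^ 2) := by
    filter_upwards [ae_ne_zero] with x hx
    have hud : DifferentiableAt ℝ u x := hu.contDiff_one.differentiable one_ne_zero x
    have d2 := (contDiffOn_norm_rpow (N := N) (-s) 1).differentiableAt_of_ne_zero hx
    have h1 := xDotGrad_mul (hud.pow 2) d2
    have h2 := xDotGrad_mul ((hud.pow 2).mul d2) (hFc.differentiable one_ne_zero x)
    have h1' : _root_.xDotGrad (fun x => u x ^ 2 * ‖x‖ ^ (-s)) x = _ := h1
    have h2' : _root_.xDotGrad (fun x => u x ^ 2 * ‖x‖ ^ (-s) * F x) x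
      = u x ^ 2 * ‖x‖ ^ (-s) * _root_.xDotGrad F x
        + F x * _root_.xDotGrad (fun x => u x ^ 2 * ‖x‖ ^ (-s)) x := h2
    have h3 : _root_.xDotGrad (u ^ 2) x = _ := xDotGrad_sq hud
    rw [h2', h1', hF' x hx, xDotGrad_norm_rpow _ hx, h3]
    simp only [Pi.pow_apply]
    ring
  have j12 : Integrable (fun x => 2 * (u x * _root_.xDotGrad u x * ‖x‖ ^ (-s) * F x)
      + -s * (u x ^ 2 * ‖x‖ ^ (-s) * F x)) := (j2.const_mul 2).add (j1.const_mul (-s))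
  have jall := j12.add (j3.const_mul 2)
  have hcd : ContDiffOn ℝ 1 (fun x => u x ^ 2 * ‖x‖ ^ (-s) * F x) {0}ᶜ :=
    ((hu.contDiff_one.contDiffOn.pow 2).mul (contDiffOn_norm_rpow _ _)).mul hFc.contDiffOn
  have hI := integral_xDotGrad hcd j1 (jall.congr hae.symm)
  rw [integral_congr_ae hae, integral_add j12 (j3.const_mul 2),
    integral_add (j2.const_mul 2) (j1.const_mul (-s)), integral_const_mul, integral_const_mul,
    integral_const_mul] at hI
  have hhalf (x : EuclideanSpace ℝ (Fin N)) : ‖x‖ ^ (-s) = (‖x‖ ^ (-s / 2)) ^ 2 := by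
    rw [← Real.rpow_natCast (‖x‖ ^ (-s / 2)), ← Real.rpow_mul (norm_nonneg x)]
    congr 1
    push_cast
    ring
  have e1 (x : EuclideanSpace ℝ (Fin N)) : (u x * ‖x‖ ^ (-s / 2) * F x) ^ 2
      = u x ^ 2 * ‖x‖ ^ (-s) * F x ^ 2 := by rw [hhalf]; ring
  have e2 (x : EuclideanSpace ℝ (Fin N)) :
      ((_root_.xDotGrad u x - -((N - s) / 2) * u x) * ‖x‖ ^ (-s / 2)) ^ 2
      = (_root_.xDotGrad u x - -((N - s) / 2) * u x) ^ 2 * ‖x‖ ^ (-s) := by rw [hhalf]; ring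
  have e3 (x : EuclideanSpace ℝ (Fin N)) : (u x * ‖x‖ ^ (-s / 2) * F x)
      * ((_root_.xDotGrad u x - -((N - s) / 2) * u x) * ‖x‖ ^ (-s / 2))
      = u x * _root_.xDotGrad u x * ‖x‖ ^ (-s) * F x
        + (N - s) / 2 * (u x ^ 2 * ‖x‖ ^ (-s) * F x) := by rw [hhalf]; ring
  have jF2 := mulInt (ψ := fun x => F x ^ 2) i1 (hFc.continuous.pow 2) (fun x => by
    rw [abs_of_nonneg (by positivity)]
    exact pow_le_one₀ (hF0 x) (hF1 x))
  have hCS := sq_integral_mul_le (μ := volume) (f := fun x => u x * ‖x‖ ^ (-s / 2) * F x)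
    (g := fun x => (_root_.xDotGrad u x - -((N - s) / 2) * u x) * ‖x‖ ^ (-s / 2))
    (by simpa only [e1] using jF2) (by simpa only [e2] using i4)
    (by simp only [e3]; exact j2.add (j1.const_mul ((N - s) / 2)))
  simp only [e1, e2, e3] at hCS
  rw [integral_add j2 (j1.const_mul _), integral_const_mul] at hCS
  have hle : ∫ x, u x ^ 2 * ‖x‖ ^ (-s) * F x ^ 2 ≤ ∫ x, u x ^ 2 * ‖x‖ ^ (-s) :=
    integral_mono jF2 i1 fun x =>
      mul_le_of_le_one_right (by positivity) (pow_le_one₀ (hF0 x) (hF1 x))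
  have e4 (x : EuclideanSpace ℝ (Fin N)) : (u x * hardyWeight x) ^ 2 * ‖x‖ ^ (-s)
      = u x ^ 2 * ‖x‖ ^ (-s) * hardyWeight x ^ 2 := by ring
  rw [weightedSq_eq_ofReal (by simpa only [e4] using j3), weightedSq_eq_ofReal i1,
    weightedSq_eq_ofReal i4, ← ENNReal.ofReal_mul (integral_nonneg fun x => by positivity),
    ← ENNReal.ofReal_pow (integral_nonneg fun x => by positivity)]
  refine ENNReal.ofReal_le_ofReal ?_
  simp only [e4]
  have h5 : ∫ x, u x ^ 2 * ‖x‖ ^ (-s) * hardyWeight x ^ 2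
      = -((∫ x, u x * _root_.xDotGrad u x * ‖x‖ ^ (-s) * F x)
        + (N - s) / 2 * ∫ x, u x ^ 2 * ‖x‖ ^ (-s) * F x) := by linarith
  rw [h5, neg_sq]
  exact hCS.trans (mul_le_mul_of_nonneg_right hle (integral_nonneg fun x => by positivity))

/-- A minimizer would have approximating test functions whose Hardy remainders tend to 0. These
functions then tend to 0 after multiplication by the positive `hardyWeight`, so the minimizer
vanishes almost everywhere. -/
theorem not_cknAchievedBy_hardy [NeZero N] (b : ℝ) :
    ¬ ∃ u G : EuclideanSpace ℝ (Fin N) → ℝ, CKNAchievedBy (b + 1) b u G := by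
  rintro ⟨u, G, hmem, hu0, hq⟩
  obtain ⟨hut, hGt, φ, hφ, hsub, hlimW, hlimV⟩ := hmem.exists_seq
  rw [cknConst_hardy, cknQuotient_eq] at hq
  rw [show b + 1 + b + 1 = 2 * b + 2 by ring, show 2 * (b + 1) = 2 * b + 2 by ring] at hq
  rw [show 2 * (b + 1) = 2 * b + 2 by ring] at hut hsub hlimW
  set s := 2 * b + 2
  set c := ENNReal.ofReal (|(N : ℝ) - s| / 2)
  have hW0 : weightedSq s u ≠ 0 := by rwa [Ne, weightedSq_eq_zero_iff hmem.1]
  have hw0 : weightedNorm s u ≠ 0 := fun h => hW0 (by rw [weightedSq_eq_sq, h]; simp)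
  have hwt : weightedNorm s u ≠ ⊤ := fun h => hut (by rw [weightedSq_eq_sq, h]; simp)
  have hV : weightedSq s G = c ^ 2 * weightedSq s u := by
    rw [eq_comm, ENNReal.eq_div_iff hW0 hut, weightedSq_eq_sq, sq, mul_assoc,
      ENNReal.mul_right_inj hw0 hwt] at hq
    rw [weightedSq_eq_sq, ← hq, weightedSq_eq_sq]
    ring
  -- By `CKNTest.weightedSq_xDotGrad_eq` the remainder of φ n is its deficit in Hardy's inequality,
  -- and the deficit converges to that of u, which is 0 by `hV`.
  have hR : Tendsto (fun n => weightedSq s (fun x =>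
      xDotGrad (φ n) x - -((N - s) / 2) * φ n x)) atTop (𝓝 0) := by
    have h1 := ENNReal.Tendsto.sub hlimV (ENNReal.Tendsto.const_mul hlimW
      (a := c ^ 2) (Or.inr (ENNReal.pow_ne_top ENNReal.ofReal_ne_top))) (Or.inl hGt)
    rw [hV, tsub_self] at h1
    refine h1.congr fun n => ?_
    rw [(hφ n).weightedSq_xDotGrad_eq s]
    exact ENNReal.add_sub_cancel_left (ENNReal.mul_ne_top
      (ENNReal.pow_ne_top ENNReal.ofReal_ne_top) ((hφ n).weightedSq_ne_top _))
  have hS : Tendsto (fun n => weightedSq s (fun x => φ n x * hardyWeight x) ^ 2) atTop (𝓝 0) := by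
    have h1 := ENNReal.Tendsto.mul hlimW (Or.inr ENNReal.zero_ne_top) hR (Or.inr hut)
    rw [mul_zero] at h1
    exact tendsto_of_tendsto_of_tendsto_of_le_of_le tendsto_const_nhds h1 (fun _ => zero_le)
      fun n => (hφ n).weightedSq_mul_hardyWeight_sq_le s
  have hS' : Tendsto (fun n => weightedSq s (fun x => φ n x * hardyWeight x)) atTop (𝓝 0) := by
    have h1 := (ENNReal.continuous_rpow_const (y := (1 / 2 : ℝ))).tendsto 0 |>.comp hS
    rw [ENNReal.zero_rpow_of_pos (by norm_num)] at h1
    refine h1.congr fun n => ?_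
    simp only [Function.comp_apply]
    rw [← ENNReal.rpow_natCast, ← ENNReal.rpow_mul]
    norm_num
  have hd : Tendsto (fun n => weightedSq s (fun x =>
      u x * hardyWeight x - φ n x * hardyWeight x)) atTop (𝓝 0) := by
    refine tendsto_of_tendsto_of_tendsto_of_le_of_le tendsto_const_nhds hsub (fun _ => zero_le)
      fun n => weightedSq_mono fun x => ?_
    rw [← sub_mul, abs_mul, abs_of_nonneg (hardyWeight_nonneg x), abs_sub_comm]
    exact mul_le_of_le_one_right (abs_nonneg _) (hardyWeight_le_one x)
  have hwm : AEStronglyMeasurable (hardyWeight : EuclideanSpace ℝ (Fin N) → ℝ) volume :=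
    continuous_hardyWeight.aestronglyMeasurable
  have hzero : weightedNorm s (fun x => u x * hardyWeight x) = 0 := by
    have h1 := (tendsto_weightedNorm_of_weightedSq hS').add
      (tendsto_weightedNorm_of_weightedSq hd)
    rw [add_zero] at h1
    exact le_antisymm (ge_of_tendsto' h1 fun n =>
      weightedNorm_le_add_sub (hmem.1.mul hwm) ((hφ n).aestronglyMeasurable.mul hwm)) zero_le
  have hzero' : weightedSq s (fun x => u x * hardyWeight x) = 0 := by
    rw [weightedSq_eq_sq, hzero]; simp
  rw [weightedSq_eq_zero_iff (f := fun x => u x * hardyWeight x) (hmem.1.mul hwm)] at hzero'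
  refine hu0 ?_
  filter_upwards [hzero', ae_ne_zero] with x hx hx0
  have hpos : hardyWeight x ≠ 0 := by
    have := norm_pos_iff.2 hx0
    unfold hardyWeight
    positivity
  simpa [hpos] using hx

end Hardy

/-! ### The regions A and B, and the final assembly. -/

section Minimizers

variable {N : ℕ} {a b t : ℝ} {D : EuclideanSpace ℝ (Fin N) → ℝ}

theorem minimizerA_eq (a b t : ℝ) (D : EuclideanSpace ℝ (Fin N) → ℝ) :
    minimizerA a b t D = powerExpProfile 0 (b + 1 - a) t D := by
  funext x
  simp [minimizerA, powerExpProfile]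

theorem minimizerB_eq (a b t : ℝ) (D : EuclideanSpace ℝ (Fin N) → ℝ) :
    minimizerB a b t D = powerExpProfile (2 * (b + 1) - N) (b + 1 - a) t D := rfl

theorem regionA_nonneg (h : (a, b) ∈ regionA N) :
    b + 1 - a ≠ 0 ∧ 0 ≤ (b + 1 - a) * (2 * 0 + ((N : ℝ) - (2 * b + 2))) := by
  simp only [regionA, regionA1, regionA2, mem_union, mem_ofPred_eq] at h
  rcases h with ⟨h1, h2⟩ | ⟨h1, h2⟩
  · exact ⟨h1.ne', mul_nonneg h1.le (by linarith)⟩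
  · exact ⟨h1.ne, mul_nonneg_of_nonpos_of_nonpos h1.le (by linarith)⟩

theorem regionB_nonneg (h : (a, b) ∈ regionB N) : b + 1 - a ≠ 0 ∧
    0 ≤ (b + 1 - a) * (2 * (2 * (b + 1) - N) + ((N : ℝ) - (2 * b + 2))) := by
  simp only [regionB, regionB1, regionB2, mem_union, mem_ofPred_eq] at h
  rcases h with ⟨h1, h2⟩ | ⟨h1, h2⟩
  · exact ⟨h1.ne, mul_nonneg_of_nonpos_of_nonpos h1.le (by linarith)⟩
  · exact ⟨h1.ne', mul_nonneg h1.le (by linarith)⟩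

/-- On the boundary b = (N-2)/2 the exponent γ is 0 and the two families of minimizers coincide;
away from it the sign condition is strict. -/
theorem powerB_cases (h : 0 ≤ (b + 1 - a) * (2 * (2 * (b + 1) - N) + ((N : ℝ) - (2 * b + 2))))
    (hk : b + 1 - a ≠ 0) :
    2 * (b + 1) - (N : ℝ) = 0 ∨ 2 * (b + 1) - (N : ℝ) + (N - (2 * b + 2)) = 0 ∧
      0 < (b + 1 - a) * (2 * (2 * (b + 1) - N) + ((N : ℝ) - (2 * b + 2))) := by
  rcases eq_or_ne (2 * (b + 1) - (N : ℝ)) 0 with h0 | h0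
  · exact Or.inl h0
  · refine Or.inr ⟨by ring, lt_of_le_of_ne h (Ne.symm (mul_ne_zero hk ?_))⟩
    intro h'
    exact h0 (by linarith)

theorem minimizerA_achieves [NeZero N] (hD : AngularProfile D)
    (h : (a, b) ∈ regionA1 N ∧ t < 0 ∨ (a, b) ∈ regionA2 N ∧ 0 < t) :
    CKNAchievedBy a b (minimizerA a b t D) (xDotGrad (minimizerA a b t D)) := by
  have hA : (a, b) ∈ regionA N := h.imp (fun h => h.1) fun h => h.1
  obtain ⟨hk0, hp⟩ := regionA_nonneg hA
  have htk : t * (b + 1 - a) < 0 := by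
    rcases h with ⟨h1, h2⟩ | ⟨h1, h2⟩
    · exact mul_neg_of_neg_of_pos h2 h1.1
    · exact mul_neg_of_pos_of_neg h2 h1.1
  obtain ⟨h1, h2⟩ := hD.powerExpProfile_spec rfl htk hp (Or.inl rfl)
  rw [minimizerA_eq]
  exact ⟨h1, hD.not_ae_eq_zero, h2.trans (cknConst_eq_of_profile rfl hk0 hp (Or.inl rfl)).symm⟩

theorem minimizerB_achieves [NeZero N] (hD : AngularProfile D)
    (h : (a, b) ∈ regionB1 N ∧ 0 < t ∨ (a, b) ∈ regionB2 N ∧ t < 0) :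
    CKNAchievedBy a b (minimizerB a b t D) (xDotGrad (minimizerB a b t D)) := by
  have hB : (a, b) ∈ regionB N := h.imp (fun h => h.1) fun h => h.1
  obtain ⟨hk0, hp⟩ := regionB_nonneg hB
  have htk : t * (b + 1 - a) < 0 := by
    rcases h with ⟨h1, h2⟩ | ⟨h1, h2⟩
    · exact mul_neg_of_pos_of_neg h2 h1.1
    · exact mul_neg_of_neg_of_pos h2 h1.1
  have hγ := powerB_cases hp hk0
  obtain ⟨h1, h2⟩ := hD.powerExpProfile_spec rfl htk hp hγ
  rw [minimizerB_eq]
  exact ⟨h1, hD.not_ae_eq_zero, h2.trans (cknConst_eq_of_profile rfl hk0 hp hγ).symm⟩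

end Minimizers

theorem theorem2p1 (N : ℕ) (hN : 1 ≤ N) (a b : ℝ) :
    -- the infimum is the largest constant in the inequality, and is the same on the completion
    IsGreatest {C : ℝ≥0∞ | ∀ u : EuclideanSpace ℝ (Fin N) → ℝ, CKNTest u → CKNIneq a b C u}
      (cknConst N a b) ∧
    cknConst N a b = cknConstCompletion N a b ∧
    -- region A
    ((a, b) ∈ regionA N →
      cknConst N a b = ENNReal.ofReal (|(N : ℝ) - (a + b + 1)| / 2) ∧
      ∀ (t : ℝ) (D : EuclideanSpace ℝ (Fin N) → ℝ), AngularProfile D →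
        ((a, b) ∈ regionA1 N ∧ t < 0 ∨ (a, b) ∈ regionA2 N ∧ 0 < t) →
        CKNAchievedBy a b (minimizerA a b t D) (xDotGrad (minimizerA a b t D))) ∧
    -- region B
    ((a, b) ∈ regionB N →
      cknConst N a b = ENNReal.ofReal (|(N : ℝ) - (3 * b - a + 3)| / 2) ∧
      ∀ (t : ℝ) (D : EuclideanSpace ℝ (Fin N) → ℝ), AngularProfile D →
        ((a, b) ∈ regionB1 N ∧ 0 < t ∨ (a, b) ∈ regionB2 N ∧ t < 0) →
        CKNAchievedBy a b (minimizerB a b t D) (xDotGrad (minimizerB a b t D))) ∧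
    -- the degenerate line
    (a = b + 1 →
      (∀ (C : ℝ≥0∞) (u : EuclideanSpace ℝ (Fin N) → ℝ), CKNTest u →
        (CKNIneq (b + 1) b C u ↔ HardyIneq b C u)) ∧
      IsGreatest {C : ℝ≥0∞ | ∀ u : EuclideanSpace ℝ (Fin N) → ℝ, CKNTest u → HardyIneq b C u}
        (cknConst N (b + 1) b) ∧
      cknConst N (b + 1) b = ENNReal.ofReal (|(N : ℝ) - 2 * (b + 1)| / 2) ∧
      ¬ ∃ u G : EuclideanSpace ℝ (Fin N) → ℝ, CKNAchievedBy (b + 1) b u G) := by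
  have : NeZero N := ⟨by omega⟩
  refine ⟨isGreatest_cknConst a b, cknConst_eq_cknConstCompletion a b, fun hA => ⟨?_, ?_⟩,
    fun hB => ⟨?_, ?_⟩, fun _ => ⟨fun C u hu => hu.cknIneq_iff_hardyIneq b C, ?_,
      cknConst_hardy b, not_cknAchievedBy_hardy b⟩⟩
  · obtain ⟨hk0, hp⟩ := regionA_nonneg hA
    rw [cknConst_eq_of_profile rfl hk0 hp (Or.inl rfl), mul_zero, add_zero]
  · exact fun t D hD h => minimizerA_achieves hD h
  · obtain ⟨hk0, hp⟩ := regionB_nonneg hB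
    -- With γ = 2(b+1) - N one has N-(a+b+1)+2γ = -(N-(3b-a+3)), hence the sign change.
    rw [cknConst_eq_of_profile rfl hk0 hp (powerB_cases hp hk0), ← abs_neg]
    congr 3
    ring
  · exact fun t D hD h => minimizerB_achieves hD h
  · convert isGreatest_cknConst (N := N) (b + 1) b using 1
    ext C
    exact forall₂_congr fun u hu => (hu.cknIneq_iff_hardyIneq b C).symm
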